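/- **Conventions.** All Lie groups and Lie algebras are real and finite-dimensional. Two torsion-free affine connections $\nabla,\nabla'$ on a manifold are *projectively equivalent*, $\nabla\sim\nabla'$, if there is a (smooth) 1-form $\phi$ with $\nabla_XY-\nabla'_XY=\phi(X)Y+\phi(Y)X$ for all vector fields $X,Y$. Let $\nabla_0$ be the standard flat connection on $\mathbb R^n$. Let $L$ be an $n$-dimensional Lie group, with left translations $L_g$, and let $\nabla$ be a smooth torsion-free affine connection on $L$. - The class $[\nabla]$ is an *IFPS* (left invariant flat projective structure) on $L$ if every point of $L$ has an open neighbourhood $U$ and a diffeomorphism $f$ from $U$ onto an open subset of $\mathbb R^n$ with $f^*\nabla_0\sim\nabla$ on $U$, and $L_g^*\nabla\sim\nabla$ for all $g\in L$. - $\nabla$ is an *IFAS* (left invariant flat affine structure) on $L$ if every point of $L$ has an open neighbourhood $U$ and a diffeomorphism $f$ from $U$ onto an open subset of $\mathbb R^n$ with $f^*\nabla_0=\nabla$ on $U$, and $L_g^*\nabla=\nabla$ for all $g\in L$. A Lie algebra *admits an IFPS* (resp. *IFAS*) if some Lie group with that Lie algebra admits one. An IFAS $\nabla$ on a Lie group $H$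 with Lie algebra $\mathfrak h$ defines $g:\mathfrak h\to\mathfrak{gl}(\mathfrak h)$, where $g(x)y$ is the value at the identity of $\nabla_{\tilde x}\tilde y$, with $\tilde x,\tilde y$ the left invariant vector fields of $x,y$. It is *reducible* if there is a semidirect sum decomposition $\mathfrak h=\mathfrak a\ltimes\mathfrak h'$ (a vector space direct sum of a subalgebra $\mathfrak a$ and an ideal $\mathfrak h'$) such that $\dim\mathfrak a=1$, $g(\mathfrak h')\mathfrak a=0$ and $g(\mathfrak h)\mathfrak h'\subseteq\mathfrak h'$. A Lie algebra *admits a reducible IFAS* if some Lie group with that Lie algebra carries one. **Proposition.** Suppose that a Lie algebra $\mathfrak l$ admits an IFPS and a Lie algebra $\mathfrak h$ admits a reducible IFAS. Then the direct sum $\mathfrak l\oplus\mathfrak h$ admits an IFAS. -/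

import Mathlib

open scoped Manifold ContDiff

universe u

noncomputable section

/-- The smoothness class for which the Lie algebra of a Lie group is defined is at most `∞`. -/
instance leInfty_minSmoothness_real_three : ENat.LEInfty (minSmoothness ℝ 3) where
  out := by
    rw [minSmoothness_of_isRCLikeNormedField]
    exact ENat.LEInfty.out

section Connections

variable {E : Type*} [NormedAddCommGroup E] [NormedSpace ℝ E]
  {M : Type*} [TopologicalSpace M] [ChartedSpace E M]
  {N : Type*} [TopologicalSpace N] [ChartedSpace E N]

variable (E M) in
/-- The underlying operation of an affine connection on `M`: the value `D Y x v` is the covariant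
derivative of the vector field `Y` at the point `x` in the direction `v`. -/
abbrev ConnectionMap : Type _ :=
  (Π x : M, TangentSpace 𝓘(ℝ, E) x) →
    (Π x : M, TangentSpace 𝓘(ℝ, E) x →L[ℝ] TangentSpace 𝓘(ℝ, E) x)

variable (E) in
/-- The standard flat connection on the vector space `E`, for which the coordinate vector fields
are parallel: the usual derivative of vector fields. -/
def standardConnection : ConnectionMap E E :=
  fun Y x ↦ fderiv ℝ (fun z ↦ (Y z : E)) x

/-- The pull-back `f^* D` of a connection under a (local) diffeomorphism `f` with inverse `f'`:
`(f^* D)_v Y = (df)⁻¹ (D_{df v} (f_* Y))`, where the push-forward `f_* Y` is the pull-back of `Y`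
under `f'`. -/
def pullbackConnection (f : M → N) (f' : N → M) (D : ConnectionMap E N) : ConnectionMap E M :=
  fun Y x ↦
    ((mfderiv 𝓘(ℝ, E) 𝓘(ℝ, E) f x).inverse.comp
      (D (VectorField.mpullback 𝓘(ℝ, E) 𝓘(ℝ, E) f' Y) (f x))).comp
        (mfderiv 𝓘(ℝ, E) 𝓘(ℝ, E) f x)

variable [IsManifold 𝓘(ℝ, E) ∞ M]

/-- Two connections agree on `U`. As a covariant derivative is only meaningful on vector fields
that are differentiable at the point in question, only those are tested. -/
def ConnectionEqOn (U : Set M) (D D' : ConnectionMap E M) : Prop :=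
  ∀ x ∈ U, ∀ Y : Π x : M, TangentSpace 𝓘(ℝ, E) x, MDiffAt (T% Y) x →
    ∀ v : TangentSpace 𝓘(ℝ, E) x, D Y x v = D' Y x v

/-- `φ` is a smooth 1-form on `U`: it takes smooth vector fields to smooth functions. -/
def IsSmoothOneFormOn (U : Set M) (φ : Π x : M, TangentSpace 𝓘(ℝ, E) x →L[ℝ] ℝ) : Prop :=
  ∀ X : Π x : M, TangentSpace 𝓘(ℝ, E) x, CMDiff ∞ (T% X) →
    CMDiff[U] ∞ (fun x ↦ φ x (X x))

/-- Projective equivalence on `U`: `D_X Y - D'_X Y = φ(X) Y + φ(Y) X` for a 1-form `φ` on `U`. -/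
def ProjectivelyEquivalentOn (U : Set M) (D D' : ConnectionMap E M) : Prop :=
  ∃ φ : Π x : M, TangentSpace 𝓘(ℝ, E) x →L[ℝ] ℝ, IsSmoothOneFormOn U φ ∧
    ∀ x ∈ U, ∀ Y : Π x : M, TangentSpace 𝓘(ℝ, E) x, MDiffAt (T% Y) x →
      ∀ v : TangentSpace 𝓘(ℝ, E) x, D Y x v - D' Y x v = φ x v • Y x + φ x (Y x) • v

end Connections

section LieGroups

variable {E : Type*} [NormedAddCommGroup E] [NormedSpace ℝ E] [FiniteDimensional ℝ E]
  [CompleteSpace E]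
  {G : Type*} [Group G] [TopologicalSpace G] [ChartedSpace E G] [LieGroup 𝓘(ℝ, E) ∞ G]

/-- The connection `D` is a representative of a left invariant flat projective structure (IFPS) on
the Lie group `G`. Local diffeomorphisms into `ℝⁿ` are charts of the maximal smooth atlas, with
values in the model space `E ≅ ℝⁿ`. -/
structure IsIFPS (D : CovariantDerivative 𝓘(ℝ, E) E (TangentSpace 𝓘(ℝ, E) : G → Type _)) :
    Prop where
  smooth : D.ContMDiffCovariantDerivative ∞
  torsion_free : D.torsion = 0
  flat : ∀ p : G, ∃ f ∈ IsManifold.maximalAtlas 𝓘(ℝ, E) ∞ G, p ∈ f.source ∧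
    ProjectivelyEquivalentOn f.source (pullbackConnection f f.symm (standardConnection E)) D
  left_invariant : ∀ g : G,
    ProjectivelyEquivalentOn Set.univ (pullbackConnection (g * ·) (g⁻¹ * ·) D) D

/-- The connection `D` is a left invariant flat affine structure (IFAS) on the Lie group `G`. -/
structure IsIFAS (D : CovariantDerivative 𝓘(ℝ, E) E (TangentSpace 𝓘(ℝ, E) : G → Type _)) :
    Prop where
  smooth : D.ContMDiffCovariantDerivative ∞
  torsion_free : D.torsion = 0
  flat : ∀ p : G, ∃ f ∈ IsManifold.maximalAtlas 𝓘(ℝ, E) ∞ G, p ∈ f.source ∧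
    ConnectionEqOn f.source (pullbackConnection f f.symm (standardConnection E)) D
  left_invariant : ∀ g : G,
    ConnectionEqOn Set.univ (pullbackConnection (g * ·) (g⁻¹ * ·) D) D

/-- The map `g : 𝔤 → 𝔤𝔩(𝔤)` attached to a connection on a Lie group, `g(x) y = ∇_x y`: the covariant
derivative at the identity of the left invariant vector field of `y` in the direction `x`. -/
def invariantAction (D : CovariantDerivative 𝓘(ℝ, E) E (TangentSpace 𝓘(ℝ, E) : G → Type _))
    (x y : GroupLieAlgebra 𝓘(ℝ, E) G) : GroupLieAlgebra 𝓘(ℝ, E) G :=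
  D (mulInvariantVectorField y) 1 x

/-- Reducibility of a left invariant connection: the Lie algebra is a semidirect sum `𝔞 ⋉ 𝔥'` of a
one-dimensional subalgebra `𝔞` and an ideal `𝔥'` with `g(𝔥')𝔞 = 0` and `g(𝔤)𝔥' ⊆ 𝔥'`. -/
def IsReducible (D : CovariantDerivative 𝓘(ℝ, E) E (TangentSpace 𝓘(ℝ, E) : G → Type _)) : Prop :=
  ∃ (𝔞 : LieSubalgebra ℝ (GroupLieAlgebra 𝓘(ℝ, E) G))
    (𝔥' : LieIdeal ℝ (GroupLieAlgebra 𝓘(ℝ, E) G)),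
    IsCompl 𝔞.toSubmodule 𝔥'.toSubmodule ∧
    Module.finrank ℝ 𝔞 = 1 ∧
    (∀ y ∈ 𝔥', ∀ a ∈ 𝔞, invariantAction D y a = 0) ∧
    (∀ x, ∀ y ∈ 𝔥', invariantAction D x y ∈ 𝔥')

end LieGroups

/-- A finite-dimensional real Lie group `G` (with model vector space `E`) whose Lie algebra is `𝔤`,
through a given isomorphism. -/
structure LieGroupOf (𝔤 : Type u) [LieRing 𝔤] [LieAlgebra ℝ 𝔤] : Type (u + 1) where
  E : Type u
  [normedAddCommGroup : NormedAddCommGroup E]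
  [normedSpace : NormedSpace ℝ E]
  [finiteDimensional : FiniteDimensional ℝ E]
  [completeSpace : CompleteSpace E]
  G : Type u
  [group : Group G]
  [topologicalSpace : TopologicalSpace G]
  [t2Space : T2Space G]
  [secondCountableTopology : SecondCountableTopology G]
  [chartedSpace : ChartedSpace E G]
  [lieGroup : LieGroup 𝓘(ℝ, E) ∞ G]
  lieEquiv : 𝔤 ≃ₗ⁅ℝ⁆ GroupLieAlgebra 𝓘(ℝ, E) G

attribute [instance] LieGroupOf.normedAddCommGroup LieGroupOf.normedSpace
  LieGroupOf.finiteDimensional LieGroupOf.completeSpace LieGroupOf.group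
  LieGroupOf.topologicalSpace LieGroupOf.t2Space LieGroupOf.secondCountableTopology
  LieGroupOf.chartedSpace LieGroupOf.lieGroup

section LieAlgebras

variable (𝔤 : Type u) [LieRing 𝔤] [LieAlgebra ℝ 𝔤]

/-- The Lie algebra `𝔤` admits an IFPS: a Lie group with Lie algebra `𝔤` admits one. -/
def AdmitsIFPS : Prop :=
  ∃ (L : LieGroupOf 𝔤)
    (D : CovariantDerivative 𝓘(ℝ, L.E) L.E (TangentSpace 𝓘(ℝ, L.E) : L.G → Type _)), IsIFPS D

/-- The Lie algebra `𝔤` admits an IFAS: a Lie group with Lie algebra `𝔤` admits one. -/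
def AdmitsIFAS : Prop :=
  ∃ (L : LieGroupOf 𝔤)
    (D : CovariantDerivative 𝓘(ℝ, L.E) L.E (TangentSpace 𝓘(ℝ, L.E) : L.G → Type _)), IsIFAS D

/-- The Lie algebra `𝔤` admits a reducible IFAS. -/
def AdmitsReducibleIFAS : Prop :=
  ∃ (L : LieGroupOf 𝔤)
    (D : CovariantDerivative 𝓘(ℝ, L.E) L.E (TangentSpace 𝓘(ℝ, L.E) : L.G → Type _)),
    IsIFAS D ∧ IsReducible D

end LieAlgebras

end

/-!
A left invariant structure on a Lie group is determined near the identity, and there it can be read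
in a chart through the left invariant frame `X z : 𝔤 → E` (`chartFrame`). If the connection has the
bilinear map `B` at the identity, then in an affine chart the frame satisfies the structure equation
`∂_{X x} (X y) = X (B x y)`. In a projectively flat chart the same holds up to a 1-form `η` that
depends on the point: `∂_{X x} (X y) = X (B x y + η x • y + η y • x)`
(`IsIFAS.exists_fderiv_chartFrame` and `IsIFPS.exists_fderiv_chartFrame`).

On the projective side the term in `η` disappears in homogeneous coordinates. After `B` is replaced
by the trace-free map in its projective class, there is a scaling factor `u` for which
`F = u • (1, id)` satisfies `∂ₓ∂ᵧF = ∂_{B x y}F + β x y • F`. The integrability condition of this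
system expresses the curvature of the constant map `B` through `β`, which forces `β` to be constant
as well (`exists_isConeMapOn`); only dimension one needs a separate choice of `F`. On the reducible
affine side, let `α` be the linear form with kernel `𝔥'` and `α e = 1`, where `e` spans `𝔞`.
Reducibility makes the 1-forms `α` and `α ⊗ X e` closed, so that there are a function `s` with
`∂ₓs = α x • s` and a map `Y` with `∂ₓY = X (x - α x • e)` (`exists_reduced_coordinates`).

The map `(z, w) ↦ (s w • F z, Y w)` is then an immersion into a space of one dimension more than the
product group: the homogeneous coordinate of the projective structure takes the place of the
coordinate along `𝔞`. Its second derivatives along the product frame are combinations of its first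
ones, with constant coefficients (`coneProduct`). They remain so after a linear projection that
turns the immersion into a chart (`exists_affine_coordinates`). In that chart the frame of the
product group satisfies the structure equation of an affine structure, for a constant bilinear map
`S`. The left invariant connection given by `S` is therefore flat at the identity, hence everywhere
by translation; the structure equation also makes the skew part of `S` the Lie bracket, so that this
connection is torsion-free (`isIFAS_leftInvariantConnection`).
-/

noncomputable section

open Bundle

/-! ### Frames on open sets of a vector space -/

section Frames
variable {E : Type*} [NormedAddCommGroup E] [NormedSpace ℝ E]
  {V : Type*} [NormedAddCommGroup V] [NormedSpace ℝ V]
  {W : Type*} [NormedAddCommGroup W] [NormedSpace ℝ W]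

lemma differentiableAt_of_contDiffOn {U : Set E} (hU : IsOpen U) {h : E → W}
    (hh : ContDiffOn ℝ ∞ h U) {z : E} (hz : z ∈ U) : DifferentiableAt ℝ h z :=
  (hh.contDiffAt (hU.mem_nhds hz)).differentiableAt (by simp)

/-- A smooth frame of vector fields on the open set `U` of `E`, indexed linearly by `V`: for
`x : V`, the field is `z ↦ X z x`. -/
structure IsSmoothFrameOn (X : E → V →L[ℝ] E) (U : Set E) : Prop where
  isOpen : IsOpen U
  contDiffOn : ContDiffOn ℝ ∞ X U
  isInvertible : ∀ z ∈ U, (X z).IsInvertible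

/-- The derivative of `h` along the field `z ↦ X z x` of a frame. -/
def frameDeriv (X : E → V →L[ℝ] E) (x : V) (h : E → W) (z : E) : W :=
  fderiv ℝ h z (X z x)

namespace IsSmoothFrameOn

variable {X : E → V →L[ℝ] E} {U U' : Set E}

lemma mono (hX : IsSmoothFrameOn X U) (hU' : IsOpen U') (h : U' ⊆ U) : IsSmoothFrameOn X U' :=
  ⟨hU', hX.contDiffOn.mono h, fun z hz ↦ hX.isInvertible z (h hz)⟩

lemma contDiffAt (hX : IsSmoothFrameOn X U) {z : E} (hz : z ∈ U) : ContDiffAt ℝ ∞ X z :=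
  hX.contDiffOn.contDiffAt (hX.isOpen.mem_nhds hz)

lemma differentiableAt (hX : IsSmoothFrameOn X U) {z : E} (hz : z ∈ U) :
    DifferentiableAt ℝ X z :=
  (hX.contDiffAt hz).differentiableAt (by simp)

lemma contDiffOn_frameDeriv (hX : IsSmoothFrameOn X U) {h : E → W} (hh : ContDiffOn ℝ ∞ h U)
    (x : V) : ContDiffOn ℝ ∞ (frameDeriv X x h) U :=
  (hh.fderiv_of_isOpen hX.isOpen (by simp)).clm_apply (hX.contDiffOn.clm_apply contDiffOn_const)

lemma injective (hX : IsSmoothFrameOn X U) {z : E} (hz : z ∈ U) : Function.Injective (X z) := by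
  obtain ⟨e, he⟩ := hX.isInvertible z hz
  rw [← he]
  exact e.injective

lemma surjective (hX : IsSmoothFrameOn X U) {z : E} (hz : z ∈ U) : Function.Surjective (X z) := by
  obtain ⟨e, he⟩ := hX.isInvertible z hz
  rw [← he]
  exact e.surjective

end IsSmoothFrameOn

variable {X : E → V →L[ℝ] E} {U : Set E}

lemma frameDeriv_congr {h k : E → W} (hU : IsOpen U) (hhk : Set.EqOn h k U) (x : V) {z : E}
    (hz : z ∈ U) : frameDeriv X x h z = frameDeriv X x k z := by
  unfold frameDeriv
  rw [(hhk.eventuallyEq_of_mem (hU.mem_nhds hz)).fderiv_eq]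

lemma frameDeriv_add_left (x y : V) (h : E → W) (z : E) :
    frameDeriv X (x + y) h z = frameDeriv X x h z + frameDeriv X y h z := by
  simp [frameDeriv]

lemma frameDeriv_smul_left (c : ℝ) (x : V) (h : E → W) (z : E) :
    frameDeriv X (c • x) h z = c • frameDeriv X x h z := by
  simp [frameDeriv]

lemma frameDeriv_sub_left (x y : V) (h : E → W) (z : E) :
    frameDeriv X (x - y) h z = frameDeriv X x h z - frameDeriv X y h z := by
  simp [frameDeriv]

lemma frameDeriv_add {h k : E → W} {z : E} (hh : DifferentiableAt ℝ h z)
    (hk : DifferentiableAt ℝ k z) (x : V) :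
    frameDeriv X x (fun z ↦ h z + k z) z = frameDeriv X x h z + frameDeriv X x k z := by
  unfold frameDeriv
  rw [fderiv_fun_add hh hk]
  simp

lemma frameDeriv_sub {h k : E → W} {z : E} (hh : DifferentiableAt ℝ h z)
    (hk : DifferentiableAt ℝ k z) (x : V) :
    frameDeriv X x (fun z ↦ h z - k z) z = frameDeriv X x h z - frameDeriv X x k z := by
  unfold frameDeriv
  rw [fderiv_fun_sub hh hk]
  simp

lemma frameDeriv_smul {u : E → ℝ} {k : E → W} {z : E} (hu : DifferentiableAt ℝ u z)
    (hk : DifferentiableAt ℝ k z) (x : V) :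
    frameDeriv X x (fun z ↦ u z • k z) z = frameDeriv X x u z • k z + u z • frameDeriv X x k z := by
  unfold frameDeriv
  rw [fderiv_fun_smul hu hk]
  simp [add_comm]

lemma frameDeriv_prodMk {W' : Type*} [NormedAddCommGroup W'] [NormedSpace ℝ W']
    {h : E → W} {k : E → W'} {z : E} (hh : DifferentiableAt ℝ h z)
    (hk : DifferentiableAt ℝ k z) (x : V) :
    frameDeriv X x (fun z ↦ (h z, k z)) z = (frameDeriv X x h z, frameDeriv X x k z) := by
  unfold frameDeriv
  rw [hh.fderiv_prodMk hk]
  simp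

/-- Derivatives along the fields of a frame commute up to the derivative along the Lie bracket. -/
lemma frameDeriv_comm (hX : IsSmoothFrameOn X U) {h : E → W} (hh : ContDiffOn ℝ ∞ h U) {z : E}
    (hz : z ∈ U) (x y : V) :
    frameDeriv X x (frameDeriv X y h) z - frameDeriv X y (frameDeriv X x h) z =
      fderiv ℝ h z (fderiv ℝ X z (X z x) y - fderiv ℝ X z (X z y) x) := by
  have hhz : ContDiffAt ℝ ∞ h z := hh.contDiffAt (hX.isOpen.mem_nhds hz)
  have hXz := hX.differentiableAt hz
  have hd : DifferentiableAt ℝ (fderiv ℝ h) z :=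
    (hhz.fderiv_right (m := 1) (by norm_cast)).differentiableAt (by simp)
  have key (x y : V) : frameDeriv X x (frameDeriv X y h) z =
      fderiv ℝ (fderiv ℝ h) z (X z x) (X z y) + fderiv ℝ h z (fderiv ℝ X z (X z x) y) := by
    have h1 : HasFDerivAt (fun z ↦ fderiv ℝ h z (X z y)) _ z :=
      hd.hasFDerivAt.clm_apply (hXz.hasFDerivAt.clm_apply (hasFDerivAt_const y z))
    unfold frameDeriv
    rw [h1.fderiv]
    simp [add_comm]
  have hs : IsSymmSndFDerivAt ℝ h z := hhz.isSymmSndFDerivAt (by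
    rw [minSmoothness_of_isRCLikeNormedField]; norm_cast)
  rw [key, key, hs.eq (X z x) (X z y), map_sub]
  abel

/-- The Poincaré lemma for smooth 1-forms near a point. -/
lemma exists_primitive_of_fderiv_symm [CompleteSpace W] {η : E → E →L[ℝ] W} (hU : IsOpen U)
    (hη : ContDiffOn ℝ ∞ η U)
    (hsymm : ∀ z ∈ U, ∀ v w, fderiv ℝ η z v w = fderiv ℝ η z w v) {z₀ : E} (hz₀ : z₀ ∈ U) :
    ∃ U' ⊆ U, IsOpen U' ∧ z₀ ∈ U' ∧ ∃ g : E → W, ContDiffOn ℝ ∞ g U' ∧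
      ∀ z ∈ U', fderiv ℝ g z = η z := by
  obtain ⟨r, hr, hrU⟩ := Metric.isOpen_iff.1 hU z₀ hz₀
  have hη' := hη.mono hrU
  obtain ⟨g, hg⟩ := (convex_ball z₀ r).exists_forall_hasFDerivAt_of_fderiv_symmetric
    Metric.isOpen_ball (hη'.differentiableOn (by simp)) fun z hz ↦ hsymm z (hrU hz)
  refine ⟨Metric.ball z₀ r, hrU, Metric.isOpen_ball, Metric.mem_ball_self hr, g, ?_,
    fun z hz ↦ (hg z hz).fderiv⟩
  rw [show (∞ : ℕ∞ω) = ∞ + 1 by rfl, contDiffOn_succ_iff_fderiv_of_isOpen Metric.isOpen_ball]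
  exact ⟨fun z hz ↦ (hg z hz).differentiableAt.differentiableWithinAt, by simp,
    hη'.congr fun z hz ↦ (hg z hz).fderiv⟩

lemma IsSmoothFrameOn.inverse_apply (hX : IsSmoothFrameOn X U) {z : E} (hz : z ∈ U) (x : V) :
    (X z).inverse (X z x) = x :=
  (hX.isInvertible z hz).inverse_apply_self x

section Inverse
variable [CompleteSpace V]

lemma IsSmoothFrameOn.contDiffOn_inverse (hX : IsSmoothFrameOn X U) :
    ContDiffOn ℝ ∞ (fun z ↦ (X z).inverse) U := fun z hz ↦
  ((hX.isInvertible z hz).contDiffAt_map_inverse.comp z (hX.contDiffAt hz)).contDiffWithinAt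

/-- The Poincaré lemma for a 1-form given by its values `θ z x` on the fields of a frame. -/
lemma exists_primitive_of_frame [CompleteSpace W] (hX : IsSmoothFrameOn X U)
    {θ : E → V →L[ℝ] W} (hθ : ContDiffOn ℝ ∞ θ U)
    (hclosed : ∀ z ∈ U, ∀ x y, fderiv ℝ θ z (X z x) y - fderiv ℝ θ z (X z y) x =
      θ z ((X z).inverse (fderiv ℝ X z (X z x) y - fderiv ℝ X z (X z y) x)))
    {z₀ : E} (hz₀ : z₀ ∈ U) :
    ∃ U' ⊆ U, IsOpen U' ∧ z₀ ∈ U' ∧ ∃ g : E → W, ContDiffOn ℝ ∞ g U' ∧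
      ∀ z ∈ U', ∀ x, frameDeriv X x g z = θ z x := by
  set η : E → E →L[ℝ] W := fun z ↦ (θ z).comp (X z).inverse with hηdef
  have hη : ContDiffOn ℝ ∞ η U := hθ.clm_comp hX.contDiffOn_inverse
  have hηX : ∀ z ∈ U, (η z).comp (X z) = θ z := fun z hz ↦ by
    ext x
    simp [hηdef, hX.inverse_apply hz]
  have hsymm : ∀ z ∈ U, ∀ v w, fderiv ℝ η z v w = fderiv ℝ η z w v := by
    intro z hz v w
    obtain ⟨x, rfl⟩ := hX.surjective hz v
    obtain ⟨y, rfl⟩ := hX.surjective hz w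
    have hηz : DifferentiableAt ℝ η z :=
      (hη.contDiffAt (hX.isOpen.mem_nhds hz)).differentiableAt (by simp)
    have hev : (fun z ↦ (η z).comp (X z)) =ᶠ[nhds z] θ :=
      (show Set.EqOn _ θ U from hηX).eventuallyEq_of_mem (hX.isOpen.mem_nhds hz)
    have hd (v : E) (y : V) :
        fderiv ℝ η z v (X z y) + η z (fderiv ℝ X z v y) = fderiv ℝ θ z v y := by
      rw [← hev.fderiv_eq, fderiv_clm_comp hηz (hX.differentiableAt hz)]
      simp [add_comm]
    have h1 := hd (X z x) y
    have h2 := hd (X z y) x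
    have h3 := hclosed z hz x y
    change _ = η z _ at h3
    rw [map_sub, ← h1, ← h2] at h3
    linear_combination (norm := module) h3
  obtain ⟨U', hU'U, hU', hz₀', g, hg, hgη⟩ :=
    exists_primitive_of_fderiv_symm hX.isOpen hη hsymm hz₀
  refine ⟨U', hU'U, hU', hz₀', g, hg, fun z hz x ↦ ?_⟩
  rw [frameDeriv, hgη z hz, ← hηX z (hU'U hz)]
  rfl

end Inverse

end Frames

/-! ### Functions attached to a frame -/

section Analysis
variable {E : Type*} [NormedAddCommGroup E] [NormedSpace ℝ E]
  {V : Type*} [NormedAddCommGroup V] [NormedSpace ℝ V] [CompleteSpace V]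
  {X : E → V →L[ℝ] E} {U : Set E}

/-- For an affinely flat frame whose bilinear map is reducible, with `α` vanishing on the ideal `𝔥'`
and `e` spanning `𝔞`, there are a function `s` with `d log s = α` and a map `Y` to the vector space
whose derivative is the projection along `e`. -/
lemma exists_reduced_coordinates [CompleteSpace E] (hX : IsSmoothFrameOn X U)
    {B : V →ₗ[ℝ] V →ₗ[ℝ] V}
    (hB : ∀ z ∈ U, ∀ x y, fderiv ℝ X z (X z x) y = X z (B x y)) {α : V →L[ℝ] ℝ} {e : V}
    (hα : α e = 1) (hBe : ∀ x, B x e = α x • B e e) (hBα : ∀ x y, α y = 0 → α (B x y) = 0)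
    {z₀ : E} (hz₀ : z₀ ∈ U) :
    ∃ U' ⊆ U, IsOpen U' ∧ z₀ ∈ U' ∧ ∃ (s : E → ℝ) (Y : E → E), ContDiffOn ℝ ∞ s U' ∧
      ContDiffOn ℝ ∞ Y U' ∧ (∀ z, s z ≠ 0) ∧
      (∀ z ∈ U', ∀ x, frameDeriv X x s z = α x * s z) ∧
      (∀ z ∈ U', ∀ x, frameDeriv X x Y z = X z (x - α x • e)) := by
  have hαB (x y : V) : α (B x y) = α x * α y * α (B e e) := by
    have h : B x y = α y • B x e + B x (y - α y • e) := by simp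
    rw [h, map_add, hBα x _ (by simp [hα]), hBe]
    simp
    ring
  have hαbr : ∀ z ∈ U, ∀ x y,
      α ((X z).inverse (fderiv ℝ X z (X z x) y - fderiv ℝ X z (X z y) x)) = 0 := by
    intro z hz x y
    rw [hB z hz, hB z hz, ← map_sub, hX.inverse_apply hz, map_sub, hαB x y, hαB y x]
    ring
  -- The 1-form `α` is closed; `s` is the exponential of a primitive.
  obtain ⟨U₁, hU₁U, hU₁, hz₁, t, ht, htα⟩ := exists_primitive_of_frame hX
    (θ := fun _ ↦ α) contDiffOn_const (fun z hz x y ↦ by rw [hαbr z hz]; simp) hz₀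
  -- So is the 1-form `α ⊗ X e`, with values in `E`; its primitive is the correction to `id`.
  have hXe : ContDiffOn ℝ ∞ (fun z ↦ X z e) U₁ :=
    (hX.contDiffOn.mono hU₁U).clm_apply contDiffOn_const
  obtain ⟨U₂, hU₂U, hU₂, hz₂, ν, hν, hνα⟩ := exists_primitive_of_frame (hX.mono hU₁ hU₁U)
    (θ := fun z ↦ α.smulRight (X z e)) (by
      exact (contDiff_const (c := α)).contDiffOn.smulRight hXe) (fun z hz x y ↦ by
      have hz' := hU₁U hz
      have hd (v : E) (y : V) :
          fderiv ℝ (fun z ↦ α.smulRight (X z e)) z v y = α y • fderiv ℝ X z v e := by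
        have h1 : HasFDerivAt (fun z ↦ X z e) _ z :=
          (hX.differentiableAt hz').hasFDerivAt.clm_apply (hasFDerivAt_const e z)
        have h2 : HasFDerivAt (fun z ↦ α.smulRight (X z e)) _ z :=
          ((ContinuousLinearMap.smulRightL ℝ V E α).hasFDerivAt).comp z h1
        rw [h2.fderiv]
        simp
      rw [hd, hd, ContinuousLinearMap.smulRight_apply, hαbr z hz', hB z hz', hB z hz', hBe x, hBe y]
      simp only [map_smul]
      module) hz₁
  refine ⟨U₂, hU₂U.trans hU₁U, hU₂, hz₂, fun z ↦ Real.exp (t z), fun z ↦ z - ν z,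
    (ht.mono hU₂U).exp, contDiffOn_id.sub hν, fun z ↦ (Real.exp_pos _).ne', fun z hz x ↦ ?_,
    fun z hz x ↦ ?_⟩
  · have htz : DifferentiableAt ℝ t z :=
      (ht.contDiffAt (hU₁.mem_nhds (hU₂U hz))).differentiableAt (by simp)
    have := htα z (hU₂U hz) x
    unfold frameDeriv at this ⊢
    rw [fderiv_exp htz]
    simp [this, mul_comm]
  · have hνz : DifferentiableAt ℝ ν z :=
      (hν.contDiffAt (hU₂.mem_nhds hz)).differentiableAt (by simp)
    rw [frameDeriv_sub (h := fun z ↦ z) differentiableAt_id hνz, hνα z hz]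
    simp [frameDeriv]

variable [FiniteDimensional ℝ V]

/-- The 1-form `v ↦ tr (X⁻¹ ∘ DX v)`, that is `d log |det X|`, has a primitive. -/
lemma exists_primitive_trace (hX : IsSmoothFrameOn X U) {z₀ : E} (hz₀ : z₀ ∈ U) :
    ∃ U' ⊆ U, IsOpen U' ∧ z₀ ∈ U' ∧ ∃ g : E → ℝ, ContDiffOn ℝ ∞ g U' ∧
      ∀ z ∈ U', ∀ v, fderiv ℝ g z v =
        LinearMap.trace ℝ V (((X z).inverse.comp (fderiv ℝ X z v) : V →L[ℝ] V) : V →ₗ[ℝ] V) := by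
  set T : (V →L[ℝ] V) →L[ℝ] ℝ :=
    LinearMap.toContinuousLinearMap ((LinearMap.trace ℝ V).comp
      (ContinuousLinearMap.coeLM ℝ)) with hT
  have hTcomm (A A' : V →L[ℝ] V) : T (A.comp A') = T (A'.comp A) :=
    LinearMap.trace_mul_comm ℝ (A : V →ₗ[ℝ] V) (A' : V →ₗ[ℝ] V)
  set η : E → E →L[ℝ] ℝ := fun z ↦
    T.comp ((ContinuousLinearMap.compL ℝ V E V (X z).inverse).comp (fderiv ℝ X z)) with hη
  have hI := hX.contDiffOn_inverse
  have hD : ContDiffOn ℝ ∞ (fderiv ℝ X) U := hX.contDiffOn.fderiv_of_isOpen hX.isOpen (by simp)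
  have hC : ContDiff ℝ ∞ fun A : E →L[ℝ] V ↦ ContinuousLinearMap.compL ℝ V E V A := by
    fun_prop
  have hηs : ContDiffOn ℝ ∞ η U := by
    refine (contDiffOn_const (c := T)).clm_comp (ContDiffOn.clm_comp ?_ hD)
    exact hC.comp_contDiffOn hI
  have hsymm : ∀ z ∈ U, ∀ v w, fderiv ℝ η z v w = fderiv ℝ η z w v := by
    intro z hz v w
    have hIz : DifferentiableAt ℝ (fun z ↦ (X z).inverse) z :=
      (hI.contDiffAt (hX.isOpen.mem_nhds hz)).differentiableAt (by simp)
    have hDz : DifferentiableAt ℝ (fderiv ℝ X) z :=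
      (hD.contDiffAt (hX.isOpen.mem_nhds hz)).differentiableAt (by simp)
    have hinv (v : E) : fderiv ℝ (fun z ↦ (X z).inverse) z v =
        -((X z).inverse.comp ((fderiv ℝ X z v).comp (X z).inverse)) := by
      have hev : (fun z ↦ (X z).inverse.comp (X z)) =ᶠ[nhds z]
          fun _ ↦ ContinuousLinearMap.id ℝ V :=
        (show Set.EqOn _ _ U from fun z hz ↦ by
          ext x; simp [hX.inverse_apply hz]).eventuallyEq_of_mem (hX.isOpen.mem_nhds hz)
      have h0 := hev.fderiv_eq (𝕜 := ℝ)
      rw [fderiv_clm_comp hIz (hX.differentiableAt hz)] at h0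
      ext w
      obtain ⟨x, rfl⟩ := hX.surjective hz w
      have := congr($h0 v x)
      simp only [fderiv_fun_const] at this
      simp at this
      simp [hX.inverse_apply hz]
      rw [eq_neg_iff_add_eq_zero, add_comm]
      exact this
    have hd (v w : E) : fderiv ℝ η z v w =
        T ((X z).inverse.comp (fderiv ℝ (fderiv ℝ X) z v w)) -
          T (((X z).inverse.comp (fderiv ℝ X z v)).comp ((X z).inverse.comp (fderiv ℝ X z w))) := by
      have hηz : DifferentiableAt ℝ η z :=
        (hηs.contDiffAt (hX.isOpen.mem_nhds hz)).differentiableAt (by simp)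
      have h1 : HasFDerivAt (fun z ↦ η z w) _ z :=
        hηz.hasFDerivAt.clm_apply (hasFDerivAt_const w z)
      have h2 : HasFDerivAt (fun z ↦ T ((X z).inverse.comp (fderiv ℝ X z w))) _ z :=
        T.hasFDerivAt.comp z
          (hIz.hasFDerivAt.clm_comp (hDz.hasFDerivAt.clm_apply (hasFDerivAt_const w z)))
      have h3 := congr($(h1.unique h2) v)
      simp at h3
      rw [h3]
      simp [hinv, ContinuousLinearMap.comp_assoc]
      abel
    have hs : IsSymmSndFDerivAt ℝ X z := (hX.contDiffAt hz).isSymmSndFDerivAt (by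
      rw [minSmoothness_of_isRCLikeNormedField]; norm_cast)
    rw [hd, hd, hs.eq v w, hTcomm]
  obtain ⟨U', hU'U, hU', hz', g, hg, hgη⟩ :=
    exists_primitive_of_fderiv_symm hX.isOpen hηs hsymm hz₀
  refine ⟨U', hU'U, hU', hz', g, hg, fun z hz v ↦ ?_⟩
  rw [hgη z hz]
  rfl

end Analysis

/-! ### Homogeneous coordinates for projectively flat frames -/

section Cone
variable {E : Type*} [NormedAddCommGroup E] [NormedSpace ℝ E]
  {V : Type*} [NormedAddCommGroup V] [NormedSpace ℝ V]
  {W : Type*} [NormedAddCommGroup W] [NormedSpace ℝ W]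
  {X : E → V →L[ℝ] E} {U : Set E}

/-- `F` is a cone map for the bilinear map `B` and the forms `b z`: its second derivatives along the
frame `X` are `∂ₓ∂ᵧF = ∂_{B x y}F + b x y • F`, and `F` together with its first derivatives is
linearly independent. For the projective structure with Christoffel symbols `B`, such a map lifts a
projectively flat chart to homogeneous coordinates, that is to the cone over the manifold. -/
structure IsConeMapOn (X : E → V →L[ℝ] E) (U : Set E) (B : V →ₗ[ℝ] V →ₗ[ℝ] V)
    (b : E → V → V → ℝ) (F : E → W) : Prop where
  contDiffOn : ContDiffOn ℝ ∞ F U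
  frameDeriv_frameDeriv : ∀ z ∈ U, ∀ x y, frameDeriv X x (frameDeriv X y F) z =
    frameDeriv X (B x y) F z + b z x y • F z
  independent : ∀ z ∈ U, ∀ (c : ℝ) (x : V), c • F z + frameDeriv X x F z = 0 → c = 0 ∧ x = 0

namespace IsConeMapOn

variable {B : V →ₗ[ℝ] V →ₗ[ℝ] V} {b : E → V → V → ℝ} {F : E → W}

lemma ne_zero (hF : IsConeMapOn X U B b F) {z : E} (hz : z ∈ U) : F z ≠ 0 := fun h ↦ by
  simpa using (hF.independent z hz 1 0 (by simp [h, frameDeriv])).1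

lemma symm (hF : IsConeMapOn X U B b F) (hX : IsSmoothFrameOn X U)
    (hbr : ∀ z ∈ U, ∀ x y,
      fderiv ℝ X z (X z x) y - fderiv ℝ X z (X z y) x = X z (B x y - B y x))
    {z : E} (hz : z ∈ U) (x y : V) : b z x y = b z y x := by
  have h := frameDeriv_comm hX hF.contDiffOn hz x y
  rw [hbr z hz, hF.frameDeriv_frameDeriv z hz, hF.frameDeriv_frameDeriv z hz] at h
  change _ = frameDeriv X _ F z at h
  rw [frameDeriv_sub_left] at h
  have : (b z x y - b z y x) • F z = 0 := by linear_combination (norm := module) h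
  rcases smul_eq_zero.1 this with h | h
  · linarith
  · exact absurd h (hF.ne_zero hz)

lemma add_left (hF : IsConeMapOn X U B b F) {z : E} (hz : z ∈ U) (x x' y : V) :
    b z (x + x') y = b z x y + b z x' y := by
  have h := hF.frameDeriv_frameDeriv z hz (x + x') y
  rw [frameDeriv_add_left, map_add, LinearMap.add_apply, frameDeriv_add_left,
    hF.frameDeriv_frameDeriv z hz, hF.frameDeriv_frameDeriv z hz] at h
  have : (b z (x + x') y - b z x y - b z x' y) • F z = 0 := by
    linear_combination (norm := module) -h
  rcases smul_eq_zero.1 this with h | h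
  · linarith
  · exact absurd h (hF.ne_zero hz)

lemma smul_left (hF : IsConeMapOn X U B b F) {z : E} (hz : z ∈ U) (c : ℝ) (x y : V) :
    b z (c • x) y = c * b z x y := by
  have h := hF.frameDeriv_frameDeriv z hz (c • x) y
  rw [frameDeriv_smul_left, map_smul, LinearMap.smul_apply, frameDeriv_smul_left,
    hF.frameDeriv_frameDeriv z hz] at h
  have : (b z (c • x) y - c * b z x y) • F z = 0 := by
    linear_combination (norm := module) -h
  rcases smul_eq_zero.1 this with h | h
  · linarith
  · exact absurd h (hF.ne_zero hz)

/-- The integrability condition for a cone map: the curvature of `B` is determined by `b`.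
It comes from commuting two derivatives in the third derivatives of `F`. -/
lemma gauss (hF : IsConeMapOn X U B b F) (hX : IsSmoothFrameOn X U)
    (hbr : ∀ z ∈ U, ∀ x y,
      fderiv ℝ X z (X z x) y - fderiv ℝ X z (X z y) x = X z (B x y - B y x))
    (hb : ∀ x y, ContDiffOn ℝ ∞ (fun z ↦ b z x y) U) {z : E} (hz : z ∈ U) (x y w : V) :
    b z y w • x - b z x w • y =
      B (B x y - B y x) w - (B x (B y w) - B y (B x w)) := by
  have key (x y : V) : frameDeriv X x (frameDeriv X y (frameDeriv X w F)) z =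
      frameDeriv X (B x (B y w)) F z + b z x (B y w) • F z +
        (frameDeriv X x (fun z ↦ b z y w) z • F z + b z y w • frameDeriv X x F z) := by
    rw [frameDeriv_congr hX.isOpen (fun z hz ↦ hF.frameDeriv_frameDeriv z hz y w) x hz,
      frameDeriv_add (differentiableAt_of_contDiffOn hX.isOpen
        (hX.contDiffOn_frameDeriv hF.contDiffOn _) hz)
        ((differentiableAt_of_contDiffOn hX.isOpen (hb y w) hz).fun_smul
          (differentiableAt_of_contDiffOn hX.isOpen hF.contDiffOn hz)),
      hF.frameDeriv_frameDeriv z hz, frameDeriv_smul (differentiableAt_of_contDiffOn hX.isOpen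
        (hb y w) hz) (differentiableAt_of_contDiffOn hX.isOpen hF.contDiffOn hz)]
  have h := frameDeriv_comm hX (hX.contDiffOn_frameDeriv hF.contDiffOn w) hz x y
  rw [hbr z hz, key, key] at h
  change _ = frameDeriv X _ _ z at h
  rw [hF.frameDeriv_frameDeriv z hz] at h
  have h2 := (hF.independent z hz
    (b z x (B y w) + frameDeriv X x (fun z ↦ b z y w) z -
      (b z y (B x w) + frameDeriv X y (fun z ↦ b z x w) z) - b z (B x y - B y x) w)
    (B x (B y w) - B y (B x w) - B (B x y - B y x) w + (b z y w • x - b z x w • y)) (by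
      simp only [frameDeriv_add_left, frameDeriv_sub_left, frameDeriv_smul_left]
      linear_combination (norm := module) h)).2
  linear_combination (norm := module) h2

/-- The forms `b z` do not depend on `z`: by `gauss`, `(b z - b z') y w • x` is a multiple of `y`,
for any `x`. -/
lemma eq_of_finrank_ne_one [FiniteDimensional ℝ V] (hV : Module.finrank ℝ V ≠ 1)
    (hF : IsConeMapOn X U B b F) (hX : IsSmoothFrameOn X U)
    (hbr : ∀ z ∈ U, ∀ x y,
      fderiv ℝ X z (X z x) y - fderiv ℝ X z (X z y) x = X z (B x y - B y x))
    (hb : ∀ x y, ContDiffOn ℝ ∞ (fun z ↦ b z x y) U) {z z' : E} (hz : z ∈ U) (hz' : z' ∈ U)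
    (y w : V) : b z y w = b z' y w := by
  have hzero {z : E} (hz : z ∈ U) : b z 0 w = 0 := by
    simpa using hF.smul_left hz 0 0 w
  rcases eq_or_ne y 0 with rfl | hy
  · rw [hzero hz, hzero hz']
  have : ∃ x, x ∉ Submodule.span ℝ {y} := by
    by_contra! hx
    exact hV (finrank_eq_one_iff'.2 ⟨y, hy, fun x ↦ Submodule.mem_span_singleton.1 (hx x)⟩)
  obtain ⟨x, hx⟩ := this
  have h1 := (hF.gauss hX hbr hb hz x y w).trans (hF.gauss hX hbr hb hz' x y w).symm
  by_contra hne
  refine hx (Submodule.mem_span_singleton.2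
    ⟨(b z y w - b z' y w)⁻¹ * (b z x w - b z' x w), ?_⟩)
  have h2 : (b z y w - b z' y w) • x = (b z x w - b z' x w) • y := by
    linear_combination (norm := module) h1
  rw [mul_smul, ← h2, smul_smul, inv_mul_cancel₀ (sub_ne_zero.2 hne), one_smul]

end IsConeMapOn

section
variable [FiniteDimensional ℝ V] [CompleteSpace V]

/-- In dimension one, a coordinate `f` in which the frame is constant gives the cone map `(1, f)`.
The integrability condition `IsConeMapOn.gauss` is empty in this dimension, so the general
construction does not provide constant forms `b`. -/
lemma exists_isConeMapOn_of_finrank_eq_one (hV : Module.finrank ℝ V = 1)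
    [CompleteSpace E] (hX : IsSmoothFrameOn X U) {z₀ : E} (hz₀ : z₀ ∈ U) :
    ∃ U' ⊆ U, IsOpen U' ∧ z₀ ∈ U' ∧ ∃ F : E → ℝ × E, IsConeMapOn X U' 0 (fun _ ↦ 0) F := by
  obtain ⟨v, hv, hvs⟩ := finrank_eq_one_iff'.1 hV
  obtain ⟨U', hU'U, hU', hz', f, hf, hfX⟩ := exists_primitive_of_frame hX
    (θ := fun _ ↦ X z₀) contDiffOn_const (fun z hz x y ↦ by
      obtain ⟨a, rfl⟩ := hvs x
      obtain ⟨c, rfl⟩ := hvs y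
      have : fderiv ℝ X z (X z (a • v)) (c • v) - fderiv ℝ X z (X z (c • v)) (a • v) = 0 := by
        simp only [map_smul, smul_apply]
        module
      rw [this]
      simp) hz₀
  have h1 {z : E} (hz : z ∈ U') (x : V) :
      frameDeriv X x (fun z ↦ ((1 : ℝ), f z)) z = (0, X z₀ x) := by
    rw [frameDeriv_prodMk (by fun_prop) (differentiableAt_of_contDiffOn hU' hf hz), hfX z hz]
    simp [frameDeriv]
  refine ⟨U', hU'U, hU', hz', fun z ↦ (1, f z), contDiffOn_const.prodMk hf, fun z hz x y ↦ ?_,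
    fun z hz c x h ↦ ?_⟩
  · rw [frameDeriv_congr hU' (fun z hz ↦ h1 hz y) x hz]
    simp [frameDeriv]
  · rw [h1 hz] at h
    obtain ⟨h2, h3⟩ := Prod.ext_iff.1 h
    simp at h2
    subst h2
    exact ⟨rfl, hX.injective hz₀ (by simpa using h3)⟩

/-- When `B` is trace-free, the cone map is `u • (1, id)`, where `u` is the power of `|det X|` for
which the terms in `η` cancel. -/
lemma exists_isConeMapOn_of_trace_eq_zero [CompleteSpace E]
    (hX : IsSmoothFrameOn X U) {B : V →ₗ[ℝ] V →ₗ[ℝ] V} (htr : ∀ x, LinearMap.trace ℝ V (B x) = 0)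
    (hB : ∀ z ∈ U, ∃ η : V →ₗ[ℝ] ℝ, ∀ x y,
      fderiv ℝ X z (X z x) y = X z (B x y + η x • y + η y • x))
    {z₀ : E} (hz₀ : z₀ ∈ U) :
    ∃ U' ⊆ U, IsOpen U' ∧ z₀ ∈ U' ∧ ∃ (F : E → ℝ × E) (b : E → V → V → ℝ),
      IsConeMapOn X U' B b F ∧ ∀ x y, ContDiffOn ℝ ∞ (fun z ↦ b z x y) U' := by
  obtain ⟨U', hU'U, hU', hz', g, hg, hgX⟩ := exists_primitive_trace hX hz₀
  have hX' := hX.mono hU' hU'U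
  set u : E → ℝ := fun z ↦ Real.exp (-(g z / (Module.finrank ℝ V + 1))) with hu
  have hu0 (z : E) : u z ≠ 0 := (Real.exp_pos _).ne'
  have hus : ContDiffOn ℝ ∞ u U' := (hg.div_const _).neg.exp
  -- The logarithmic derivative of `u` is the 1-form `-η`.
  have hXu : ∀ z ∈ U', ∀ x y, u z • fderiv ℝ X z (X z x) y =
      X z (u z • B x y - frameDeriv X x u z • y - frameDeriv X y u z • x) := by
    intro z hz x y
    obtain ⟨η, hη⟩ := hB z (hU'U hz)
    have htrace (x : V) : frameDeriv X x g z = (Module.finrank ℝ V + 1) * η x := by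
      rw [frameDeriv, hgX z hz]
      have : (((X z).inverse.comp (fderiv ℝ X z (X z x)) : V →L[ℝ] V) : V →ₗ[ℝ] V) =
          B x + η x • LinearMap.id + η.smulRight x := by
        ext y
        simp [hη, -map_add, hX'.inverse_apply hz]
      rw [this]
      simp [htr]
      ring
    have hux (x : V) : frameDeriv X x u z = -η x * u z := by
      have hgz : HasFDerivAt g (fderiv ℝ g z) z :=
        (differentiableAt_of_contDiffOn hU' hg hz).hasFDerivAt
      have h1 : HasFDerivAt u _ z := ((hgz.mul_const ((Module.finrank ℝ V + 1 : ℝ)⁻¹)).neg).exp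
      have h2 := htrace x
      unfold frameDeriv at h2 ⊢
      rw [h1.fderiv]
      have h3 : (Module.finrank ℝ V + 1 : ℝ) ≠ 0 := by positivity
      simp [h2, hu, div_eq_mul_inv]
      field_simp
    rw [hη, hux, hux, ← map_smul]
    congr 1
    module
  set b : E → V → V → ℝ := fun z x y ↦
    (frameDeriv X x (frameDeriv X y u) z - frameDeriv X (B x y) u z) / u z with hb
  have hub (z : E) (x y : V) : b z x y * u z =
      frameDeriv X x (frameDeriv X y u) z - frameDeriv X (B x y) u z := by
    rw [hb]
    field_simp [hu0 z]
  have hF1 {z : E} (hz : z ∈ U') (x : V) : frameDeriv X x (fun z ↦ (u z, u z • z)) z =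
      (frameDeriv X x u z, frameDeriv X x u z • z + u z • X z x) := by
    rw [frameDeriv_prodMk (differentiableAt_of_contDiffOn hU' hus hz)
      ((differentiableAt_of_contDiffOn hU' hus hz).fun_smul differentiableAt_fun_id),
      frameDeriv_smul (k := fun z ↦ z)
        (differentiableAt_of_contDiffOn hU' hus hz) differentiableAt_fun_id]
    simp [frameDeriv]
  refine ⟨U', hU'U, hU', hz', fun z ↦ (u z, u z • z), b,
    ⟨hus.prodMk (hus.smul contDiffOn_id), fun z hz x y ↦ ?_, fun z hz c x h ↦ ?_⟩,
    fun x y ↦ ((hX'.contDiffOn_frameDeriv (hX'.contDiffOn_frameDeriv hus y) x).sub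
      (hX'.contDiffOn_frameDeriv hus _)).div hus fun z _ ↦ hu0 z⟩
  · have hyu := hX'.contDiffOn_frameDeriv hus y
    have hXy : ContDiffOn ℝ ∞ (fun z ↦ X z y) U' := hX'.contDiffOn.clm_apply contDiffOn_const
    rw [frameDeriv_congr hU' (fun z hz ↦ hF1 hz y) x hz, hF1 hz,
      frameDeriv_prodMk (differentiableAt_of_contDiffOn hU' hyu hz)
        (((differentiableAt_of_contDiffOn hU' hyu hz).fun_smul differentiableAt_fun_id).fun_add
        ((differentiableAt_of_contDiffOn hU' hus hz).fun_smul
          (differentiableAt_of_contDiffOn hU' hXy hz))),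
      frameDeriv_add ((differentiableAt_of_contDiffOn hU' hyu hz).fun_smul differentiableAt_fun_id)
        ((differentiableAt_of_contDiffOn hU' hus hz).fun_smul
          (differentiableAt_of_contDiffOn hU' hXy hz)),
      frameDeriv_smul (k := fun z ↦ z)
        (differentiableAt_of_contDiffOn hU' hyu hz) differentiableAt_fun_id,
      frameDeriv_smul (differentiableAt_of_contDiffOn hU' hus hz)
        (differentiableAt_of_contDiffOn hU' hXy hz)]
    have h1 : frameDeriv X x (fun z ↦ z) z = X z x := by simp [frameDeriv]
    have h2 : frameDeriv X x (fun z ↦ X z y) z = fderiv ℝ X z (X z x) y := by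
      have : HasFDerivAt (fun z ↦ X z y) _ z :=
        (hX'.differentiableAt hz).hasFDerivAt.clm_apply (hasFDerivAt_const y z)
      rw [frameDeriv, this.fderiv]
      simp
    rw [h1, h2, hXu z hz]
    simp only [map_sub, map_smul, Prod.smul_mk, Prod.mk_add_mk, smul_eq_mul, hub, smul_smul,
      Prod.mk.injEq]
    constructor
    · ring
    · module
  · rw [hF1 hz] at h
    obtain ⟨h2, h3⟩ := Prod.ext_iff.1 h
    simp only [Prod.smul_mk, Prod.mk_add_mk, Prod.fst_zero, Prod.snd_zero, smul_eq_mul] at h2 h3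
    have h4 : u z • X z x = 0 := by
      have h5 : (c * u z + frameDeriv X x u z) • z = 0 := by rw [h2, zero_smul]
      linear_combination (norm := module) h3 - h5
    have h6 : x = 0 := hX'.injective hz (by simpa [hu0 z] using h4)
    subst h6
    refine ⟨?_, rfl⟩
    simpa [frameDeriv, hu0 z] using h2

/-- A frame that satisfies the structure equation of an invariant flat projective structure has,
locally, a cone map whose bilinear map and form are constant. -/
lemma exists_isConeMapOn [CompleteSpace E]
    (hX : IsSmoothFrameOn X U) {B : V →ₗ[ℝ] V →ₗ[ℝ] V}
    (hB : ∀ z ∈ U, ∃ η : V →ₗ[ℝ] ℝ, ∀ x y,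
      fderiv ℝ X z (X z x) y = X z (B x y + η x • y + η y • x))
    {z₀ : E} (hz₀ : z₀ ∈ U) :
    ∃ U' ⊆ U, IsOpen U' ∧ z₀ ∈ U' ∧ ∃ (B' : V →ₗ[ℝ] V →ₗ[ℝ] V) (β : V →ₗ[ℝ] V →ₗ[ℝ] ℝ)
      (F : E → ℝ × E), IsConeMapOn X U' B' (fun _ x y ↦ β x y) F := by
  by_cases hV : Module.finrank ℝ V = 1
  · obtain ⟨U', hU'U, hU', hz', F, hF⟩ := exists_isConeMapOn_of_finrank_eq_one hV hX hz₀
    exact ⟨U', hU'U, hU', hz', 0, 0, F, hF⟩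
  -- Replace `B` by the trace-free representative of its projective class.
  set n : ℝ := (Module.finrank ℝ V : ℝ) with hn
  set τ : V →ₗ[ℝ] ℝ := (n + 1)⁻¹ • (LinearMap.trace ℝ V).comp B with hτ
  set B' : V →ₗ[ℝ] V →ₗ[ℝ] V :=
    LinearMap.mk₂ ℝ (fun x y ↦ B x y - τ x • y - τ y • x)
      (fun x x' y ↦ by simp only [map_add, LinearMap.add_apply]; module)
      (fun c x y ↦ by simp only [map_smul, LinearMap.smul_apply, smul_eq_mul]; module)
      (fun x y y' ↦ by simp only [map_add]; module)
      (fun c x y ↦ by simp only [map_smul, smul_eq_mul]; module) with hB'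
  have hB'a (x y : V) : B' x y = B x y - τ x • y - τ y • x := rfl
  have htr (x : V) : LinearMap.trace ℝ V (B' x) = 0 := by
    have : B' x = B x - τ x • LinearMap.id - τ.smulRight x := by
      ext y; simp [hB'a]
    rw [this]
    have h3 : n + 1 ≠ 0 := by positivity
    simp [hτ, ← hn]
    field_simp
    ring
  have hB'X : ∀ z ∈ U, ∃ η : V →ₗ[ℝ] ℝ, ∀ x y,
      fderiv ℝ X z (X z x) y = X z (B' x y + η x • y + η y • x) := by
    intro z hz
    obtain ⟨η, hη⟩ := hB z hz
    refine ⟨η + τ, fun x y ↦ ?_⟩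
    rw [hη, hB'a]
    congr 1
    simp only [LinearMap.add_apply]
    module
  obtain ⟨U', hU'U, hU', hz', F, b, hF, hb⟩ :=
    exists_isConeMapOn_of_trace_eq_zero hX htr hB'X hz₀
  have hX' := hX.mono hU' hU'U
  have hbr : ∀ z ∈ U', ∀ x y,
      fderiv ℝ X z (X z x) y - fderiv ℝ X z (X z y) x = X z (B' x y - B' y x) := by
    intro z hz x y
    obtain ⟨η, hη⟩ := hB'X z (hU'U hz)
    rw [hη, hη, ← map_sub]
    congr 1
    module
  refine ⟨U', hU'U, hU', hz', B', LinearMap.mk₂ ℝ (b z₀) (hF.add_left hz') (hF.smul_left hz')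
    (fun x y y' ↦ by
      rw [hF.symm hX' hbr hz', hF.add_left hz', hF.symm hX' hbr hz' y, hF.symm hX' hbr hz' y'])
    (fun c x y ↦ by
      rw [hF.symm hX' hbr hz', hF.smul_left hz', hF.symm hX' hbr hz' y]; rfl), F,
    ⟨hF.contDiffOn, fun z hz x y ↦ ?_, hF.independent⟩⟩
  have h := hF.frameDeriv_frameDeriv z hz x y
  rwa [hF.eq_of_finrank_ne_one hV hX' hbr hb hz hz'] at h

end
end Cone

/-! ### Affine coordinates on a product -/

section Product
variable {E₁ : Type*} [NormedAddCommGroup E₁] [NormedSpace ℝ E₁]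
  {E₂ : Type*} [NormedAddCommGroup E₂] [NormedSpace ℝ E₂]
  {V₁ : Type*} [NormedAddCommGroup V₁] [NormedSpace ℝ V₁]
  {V₂ : Type*} [NormedAddCommGroup V₂] [NormedSpace ℝ V₂]
  {W : Type*} [NormedAddCommGroup W] [NormedSpace ℝ W]
  {X₁ : E₁ → V₁ →L[ℝ] E₁} {X₂ : E₂ → V₂ →L[ℝ] E₂} {U₁ : Set E₁} {U₂ : Set E₂}

/-- The product of two frames. -/
def prodFrame (X₁ : E₁ → V₁ →L[ℝ] E₁) (X₂ : E₂ → V₂ →L[ℝ] E₂) (p : E₁ × E₂) :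
    V₁ × V₂ →L[ℝ] E₁ × E₂ :=
  (X₁ p.1).prodMap (X₂ p.2)

lemma IsSmoothFrameOn.prodFrame (h₁ : IsSmoothFrameOn X₁ U₁) (h₂ : IsSmoothFrameOn X₂ U₂) :
    IsSmoothFrameOn (prodFrame X₁ X₂) (U₁ ×ˢ U₂) where
  isOpen := h₁.isOpen.prod h₂.isOpen
  contDiffOn := by
    have h1 : ContDiffOn ℝ ∞ (fun p : E₁ × E₂ ↦ X₁ p.1) (U₁ ×ˢ U₂) :=
      h₁.contDiffOn.comp contDiffOn_fst fun p hp ↦ hp.1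
    have h2 : ContDiffOn ℝ ∞ (fun p : E₁ × E₂ ↦ X₂ p.2) (U₁ ×ˢ U₂) :=
      h₂.contDiffOn.comp contDiffOn_snd fun p hp ↦ hp.2
    exact (ContinuousLinearMap.prodMapL ℝ V₁ E₁ V₂ E₂).contDiff.comp_contDiffOn (h1.prodMk h2)
  isInvertible := by
    rintro ⟨z, w⟩ ⟨hz, hw⟩
    obtain ⟨e₁, he₁⟩ := h₁.isInvertible z hz
    obtain ⟨e₂, he₂⟩ := h₂.isInvertible w hw
    exact ⟨e₁.prodCongr e₂, by ext x <;> simp [_root_.prodFrame, ← he₁, ← he₂]⟩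

lemma frameDeriv_prodFrame_fst {h : E₁ → W} {p : E₁ × E₂} (hh : DifferentiableAt ℝ h p.1)
    (x : V₁ × V₂) :
    frameDeriv (prodFrame X₁ X₂) x (fun p ↦ h p.1) p = frameDeriv X₁ x.1 h p.1 := by
  have : HasFDerivAt (fun p : E₁ × E₂ ↦ h p.1) _ p := hh.hasFDerivAt.comp p hasFDerivAt_fst
  rw [frameDeriv, this.fderiv]
  rfl

lemma frameDeriv_prodFrame_snd {h : E₂ → W} {p : E₁ × E₂} (hh : DifferentiableAt ℝ h p.2)
    (x : V₁ × V₂) :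
    frameDeriv (prodFrame X₁ X₂) x (fun p ↦ h p.2) p = frameDeriv X₂ x.2 h p.2 := by
  have : HasFDerivAt (fun p : E₁ × E₂ ↦ h p.2) _ p := hh.hasFDerivAt.comp p hasFDerivAt_snd
  rw [frameDeriv, this.fderiv]
  rfl

/-- The bilinear map on `V₁ × V₂` that gives the second derivatives of `(z, w) ↦ (s w • F z, Y w)`,
for a cone map `F` with data `B₁`, `β`, and the functions `s`, `Y` of `exists_reduced_coordinates`. -/
def coneProduct (B₁ : V₁ →ₗ[ℝ] V₁ →ₗ[ℝ] V₁) (β : V₁ →ₗ[ℝ] V₁ →ₗ[ℝ] ℝ)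
    (B₂ : V₂ →ₗ[ℝ] V₂ →ₗ[ℝ] V₂) (α : V₂ →L[ℝ] ℝ) (e : V₂) :
    V₁ × V₂ →ₗ[ℝ] V₁ × V₂ →ₗ[ℝ] V₁ × V₂ :=
  LinearMap.mk₂ ℝ
    (fun x y ↦ (B₁ x.1 y.1 + α x.2 • y.1 + α y.2 • x.1,
      (β x.1 y.1 + α x.2 * α y.2) • e + B₂ x.2 (y.2 - α y.2 • e)))
    (fun x x' y ↦ by
      ext <;> simp only [Prod.fst_add, Prod.snd_add, map_add, LinearMap.add_apply] <;> module)
    (fun c x y ↦ by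
      ext <;> simp only [Prod.smul_fst, Prod.smul_snd, map_smul, LinearMap.smul_apply,
        smul_eq_mul] <;> module)
    (fun x y y' ↦ by
      ext <;> simp only [Prod.fst_add, Prod.snd_add, map_add, map_sub, map_smul] <;> module)
    (fun c x y ↦ by
      ext <;> simp only [Prod.smul_fst, Prod.smul_snd, map_smul, map_sub, smul_eq_mul] <;> module)

lemma coneProduct_apply (B₁ : V₁ →ₗ[ℝ] V₁ →ₗ[ℝ] V₁) (β : V₁ →ₗ[ℝ] V₁ →ₗ[ℝ] ℝ)
    (B₂ : V₂ →ₗ[ℝ] V₂ →ₗ[ℝ] V₂) (α : V₂ →L[ℝ] ℝ) (e : V₂) (x y : V₁ × V₂) :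
    coneProduct B₁ β B₂ α e x y = (B₁ x.1 y.1 + α x.2 • y.1 + α y.2 • x.1,
      (β x.1 y.1 + α x.2 * α y.2) • e + B₂ x.2 (y.2 - α y.2 • e)) := rfl

variable [FiniteDimensional ℝ E₁] [FiniteDimensional ℝ E₂] [CompleteSpace E₁] [CompleteSpace E₂]
  [FiniteDimensional ℝ V₁] [CompleteSpace V₁] [CompleteSpace V₂]

/-- A projectively flat frame and a reducible affinely flat frame combine to an affinely flat frame
on the product: there are coordinates `Φ` whose second derivatives along the product frame are given
by a constant bilinear map. The map `(z, w) ↦ (s w • F z, Y w)` takes its values in a space with one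
dimension too many, but its second derivatives are combinations of the first ones, so that a linear
projection gives coordinates. -/
theorem exists_affine_coordinates (hX₁ : IsSmoothFrameOn X₁ U₁) (hX₂ : IsSmoothFrameOn X₂ U₂)
    {B₁ : V₁ →ₗ[ℝ] V₁ →ₗ[ℝ] V₁} {B₂ : V₂ →ₗ[ℝ] V₂ →ₗ[ℝ] V₂}
    (hB₁ : ∀ z ∈ U₁, ∃ η : V₁ →ₗ[ℝ] ℝ, ∀ x y,
      fderiv ℝ X₁ z (X₁ z x) y = X₁ z (B₁ x y + η x • y + η y • x))
    (hB₂ : ∀ z ∈ U₂, ∀ x y, fderiv ℝ X₂ z (X₂ z x) y = X₂ z (B₂ x y)) {α : V₂ →L[ℝ] ℝ} {e : V₂}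
    (hα : α e = 1) (hBe : ∀ x, B₂ x e = α x • B₂ e e) (hBα : ∀ x y, α y = 0 → α (B₂ x y) = 0)
    {p₀ : E₁ × E₂} (hp₀ : p₀ ∈ U₁ ×ˢ U₂) :
    ∃ S : V₁ × V₂ →ₗ[ℝ] V₁ × V₂ →ₗ[ℝ] V₁ × V₂, ∃ U ⊆ U₁ ×ˢ U₂,
      IsOpen U ∧ p₀ ∈ U ∧ ∃ Φ : E₁ × E₂ → E₁ × E₂, ContDiffOn ℝ ∞ Φ U ∧
        fderiv ℝ Φ p₀ = ContinuousLinearMap.id ℝ _ ∧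
        ∀ p ∈ U, ∀ x y, frameDeriv (prodFrame X₁ X₂) x (frameDeriv (prodFrame X₁ X₂) y Φ) p =
          frameDeriv (prodFrame X₁ X₂) (S x y) Φ p := by
  obtain ⟨U₁', hU₁', hU₁'o, hp₁, B, β, F, hF⟩ := exists_isConeMapOn hX₁ hB₁ hp₀.1
  obtain ⟨U₂', hU₂', hU₂'o, hp₂, s, Y, hs, hY, hs0, hsα, hYX⟩ :=
    exists_reduced_coordinates hX₂ hB₂ hα hBe hBα hp₀.2
  have hX₁' := hX₁.mono hU₁'o hU₁'
  have hX₂' := hX₂.mono hU₂'o hU₂'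
  set X := prodFrame X₁ X₂
  have hX : IsSmoothFrameOn X (U₁' ×ˢ U₂') := hX₁'.prodFrame hX₂'
  have hp₀' : p₀ ∈ U₁' ×ˢ U₂' := ⟨hp₁, hp₂⟩
  set Ψ : E₁ × E₂ → (ℝ × E₁) × E₂ := fun p ↦ (s p.2 • F p.1, Y p.2) with hΨ
  have hd1 {h : E₁ → ℝ × E₁} (hh : ContDiffOn ℝ ∞ h U₁') {p : E₁ × E₂} (hp : p ∈ U₁' ×ˢ U₂') :
      DifferentiableAt ℝ (fun p : E₁ × E₂ ↦ h p.1) p :=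
    (differentiableAt_of_contDiffOn hU₁'o hh hp.1).comp p differentiableAt_fst
  have hds {p : E₁ × E₂} (hp : p ∈ U₁' ×ˢ U₂') :
      DifferentiableAt ℝ (fun p : E₁ × E₂ ↦ s p.2) p :=
    (differentiableAt_of_contDiffOn hU₂'o hs hp.2).comp p differentiableAt_snd
  have hsF {h : E₁ → ℝ × E₁} (hh : ContDiffOn ℝ ∞ h U₁') {p : E₁ × E₂} (hp : p ∈ U₁' ×ˢ U₂')
      (x : V₁ × V₂) : frameDeriv X x (fun p ↦ s p.2 • h p.1) p =
        (α x.2 * s p.2) • h p.1 + s p.2 • frameDeriv X₁ x.1 h p.1 := by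
    rw [frameDeriv_smul (hds hp) (hd1 hh hp),
      frameDeriv_prodFrame_snd (differentiableAt_of_contDiffOn hU₂'o hs hp.2),
      frameDeriv_prodFrame_fst (differentiableAt_of_contDiffOn hU₁'o hh hp.1), hsα _ hp.2]
  have hΨ1 {p : E₁ × E₂} (hp : p ∈ U₁' ×ˢ U₂') (x : V₁ × V₂) : frameDeriv X x Ψ p =
      ((α x.2) • s p.2 • F p.1 + s p.2 • frameDeriv X₁ x.1 F p.1,
        X₂ p.2 (x.2 - α x.2 • e)) := by
    rw [hΨ, frameDeriv_prodMk (k := fun p : E₁ × E₂ ↦ Y p.2) ((hds hp).fun_smul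
      (hd1 hF.contDiffOn hp))
      ((differentiableAt_of_contDiffOn hU₂'o hY hp.2).comp p differentiableAt_snd),
      hsF hF.contDiffOn hp,
      frameDeriv_prodFrame_snd (differentiableAt_of_contDiffOn hU₂'o hY hp.2), hYX _ hp.2, mul_smul]
  have hΨs : ContDiffOn ℝ ∞ Ψ (U₁' ×ˢ U₂') :=
    ((hs.comp contDiffOn_snd fun p hp ↦ hp.2).smul
      (hF.contDiffOn.comp contDiffOn_fst fun p hp ↦ hp.1)).prodMk
      (hY.comp contDiffOn_snd fun p hp ↦ hp.2)
  have hΨ2 : ∀ p ∈ U₁' ×ˢ U₂', ∀ x y, frameDeriv X x (frameDeriv X y Ψ) p =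
      frameDeriv X (coneProduct B β B₂ α e x y) Ψ p := by
    intro p hp x y
    have hyF := hX₁'.contDiffOn_frameDeriv hF.contDiffOn y.1
    have hXy : DifferentiableAt ℝ (fun w ↦ X₂ w (y.2 - α y.2 • e)) p.2 :=
      (hX₂'.differentiableAt hp.2).clm_apply (differentiableAt_const _)
    have hXyd : fderiv ℝ (fun w ↦ X₂ w (y.2 - α y.2 • e)) p.2 (X₂ p.2 x.2) =
        X₂ p.2 (B₂ x.2 (y.2 - α y.2 • e)) := by
      have : HasFDerivAt (fun w ↦ X₂ w (y.2 - α y.2 • e)) _ p.2 :=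
        (hX₂'.differentiableAt hp.2).hasFDerivAt.clm_apply (hasFDerivAt_const _ _)
      rw [this.fderiv, ← hB₂ _ (hU₂' hp.2)]
      simp
    have hc := differentiableAt_const (𝕜 := ℝ) (E := E₁ × E₂) (x := p) (α y.2)
    rw [frameDeriv_congr hX.isOpen (fun p hp ↦ hΨ1 hp y) x hp, hΨ1 hp,
      frameDeriv_prodMk (k := fun p : E₁ × E₂ ↦ X₂ p.2 (y.2 - α y.2 • e)) ((hc.fun_smul
        ((hds hp).fun_smul (hd1 hF.contDiffOn hp))).fun_add
        ((hds hp).fun_smul (hd1 hyF hp))) (hXy.comp p differentiableAt_snd),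
      frameDeriv_add (hc.fun_smul ((hds hp).fun_smul (hd1 hF.contDiffOn hp)))
        ((hds hp).fun_smul (hd1 hyF hp)),
      frameDeriv_smul hc ((hds hp).fun_smul (hd1 hF.contDiffOn hp)),
      hsF hF.contDiffOn hp, hsF hyF hp, hF.frameDeriv_frameDeriv _ hp.1,
      frameDeriv_prodFrame_snd (h := fun w ↦ X₂ w (y.2 - α y.2 • e)) hXy]
    have hαS : α (coneProduct B β B₂ α e x y).2 = β x.1 y.1 + α x.2 * α y.2 := by
      rw [coneProduct_apply]
      simp only [map_add, map_smul, hα, hBα x.2 (y.2 - α y.2 • e) (by simp [hα])]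
      simp
    rw [hαS]
    unfold frameDeriv at hXyd ⊢
    rw [hXyd, coneProduct_apply]
    ext1
    · simp only [map_add, map_smul, fderiv_fun_const, Pi.zero_apply, zero_apply]
      module
    · simp
  -- The differential of `Ψ` at `p₀` is injective; a linear left inverse makes it invertible.
  have hinj : LinearMap.ker (fderiv ℝ Ψ p₀ : E₁ × E₂ →ₗ[ℝ] (ℝ × E₁) × E₂) = ⊥ := by
    rw [LinearMap.ker_eq_bot']
    intro v hv
    obtain ⟨x, rfl⟩ := hX.surjective hp₀' v
    have h := (hΨ1 hp₀' x).symm.trans hv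
    obtain ⟨h1, h2⟩ := Prod.ext_iff.1 h
    have h3 : α x.2 = 0 ∧ x.1 = 0 := by
      refine hF.independent _ hp₁ _ _ ?_
      have h4 : s p₀.2 • (α x.2 • F p₀.1 + frameDeriv X₁ x.1 F p₀.1) = 0 := by
        rw [smul_add, smul_comm]
        exact h1
      exact (smul_eq_zero.1 h4).resolve_left (hs0 _)
    have h5 : x.2 = 0 := by
      have := hX₂'.injective hp₂ (h2.trans (map_zero (X₂ p₀.2)).symm)
      simpa [h3.1] using this
    have : x = 0 := Prod.ext h3.2 h5
    simp [this]
  obtain ⟨g, hg⟩ := LinearMap.exists_leftInverse_of_injective _ hinj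
  set pr : (ℝ × E₁) × E₂ →L[ℝ] E₁ × E₂ := LinearMap.toContinuousLinearMap g with hpr
  have hprd {h : E₁ × E₂ → (ℝ × E₁) × E₂} {p : E₁ × E₂} (hh : DifferentiableAt ℝ h p) :
      fderiv ℝ (fun p ↦ pr (h p)) p = pr.comp (fderiv ℝ h p) :=
    (pr.hasFDerivAt.comp p hh.hasFDerivAt).fderiv
  refine ⟨coneProduct B β B₂ α e, U₁' ×ˢ U₂', Set.prod_mono hU₁' hU₂', hX.isOpen,
    hp₀', fun p ↦ pr (Ψ p), pr.contDiff.comp_contDiffOn hΨs, ?_, fun p hp x y ↦ ?_⟩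
  · rw [hprd (differentiableAt_of_contDiffOn hX.isOpen hΨs hp₀')]
    refine ContinuousLinearMap.ext fun v ↦ ?_
    exact congr($hg v)
  · have h1 (y : V₁ × V₂) {p : E₁ × E₂} (hp : p ∈ U₁' ×ˢ U₂') :
        frameDeriv X y (fun p ↦ pr (Ψ p)) p = pr (frameDeriv X y Ψ p) := by
      rw [frameDeriv, hprd (differentiableAt_of_contDiffOn hX.isOpen hΨs hp)]
      rfl
    rw [frameDeriv_congr hX.isOpen (fun p hp ↦ h1 y hp) x hp, h1 _ hp, ← hΨ2 p hp]
    have h2 := differentiableAt_of_contDiffOn hX.isOpen (hX.contDiffOn_frameDeriv hΨs y) hp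
    rw [frameDeriv, hprd h2]
    rfl

end Product

/-! ### The left invariant frame of a Lie group in a chart -/

section ModelDeriv
variable {E : Type*} [NormedAddCommGroup E] [NormedSpace ℝ E]
  {E' : Type*} [NormedAddCommGroup E'] [NormedSpace ℝ E']
  {E'' : Type*} [NormedAddCommGroup E''] [NormedSpace ℝ E'']
  {M : Type*} [TopologicalSpace M] [ChartedSpace E M]
  {N : Type*} [TopologicalSpace N] [ChartedSpace E' N]
  {P : Type*} [TopologicalSpace P] [ChartedSpace E'' P]

variable (E E') in
/-- The derivative of a map of manifolds, read as a map of the model spaces: every tangent space is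
the model space by definition. -/
def modelDeriv (f : M → N) (p : M) : E →L[ℝ] E' := mfderiv 𝓘(ℝ, E) 𝓘(ℝ, E') f p

lemma modelDeriv_comp {f : M → N} {g : N → P} {p : M}
    (hg : MDifferentiableAt 𝓘(ℝ, E') 𝓘(ℝ, E'') g (f p))
    (hf : MDifferentiableAt 𝓘(ℝ, E) 𝓘(ℝ, E') f p) :
    modelDeriv E E'' (fun q ↦ g (f q)) p = (modelDeriv E' E'' g (f p)).comp (modelDeriv E E' f p) :=
  mfderiv_comp p hg hf

lemma modelDeriv_fun_id (p : M) : modelDeriv E E (fun q : M ↦ q) p = ContinuousLinearMap.id ℝ E :=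
  mfderiv_id

lemma modelDeriv_eq_fderiv (f : E → E') (z : E) : modelDeriv E E' f z = fderiv ℝ f z :=
  mfderiv_eq_fderiv

lemma modelDeriv_congr {f f' : M → N} {p : M} (h : f =ᶠ[nhds p] f') :
    modelDeriv E E' f p = modelDeriv E E' f' p :=
  h.mfderiv_eq

variable {f : OpenPartialHomeomorph M E}

lemma modelDeriv_symm_comp (hf : f ∈ IsManifold.maximalAtlas 𝓘(ℝ, E) ∞ M) {p : M}
    (hp : p ∈ f.source) :
    (modelDeriv E E f.symm (f p)).comp (modelDeriv E E f p) = ContinuousLinearMap.id ℝ E := by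
  rw [← modelDeriv_comp, ← modelDeriv_fun_id p]
  · exact modelDeriv_congr (by
      filter_upwards [f.open_source.mem_nhds hp] with q hq using f.left_inv hq)
  · exact (contMDiffAt_symm_of_mem_maximalAtlas hf (f.map_source hp)).mdifferentiableAt (by simp)
  · exact (contMDiffAt_of_mem_maximalAtlas hf hp).mdifferentiableAt (by simp)

lemma modelDeriv_comp_symm (hf : f ∈ IsManifold.maximalAtlas 𝓘(ℝ, E) ∞ M) {p : M}
    (hp : p ∈ f.source) :
    (modelDeriv E E f p).comp (modelDeriv E E f.symm (f p)) = ContinuousLinearMap.id ℝ E := by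
  have h : f.symm (f p) = p := f.left_inv hp
  rw [← modelDeriv_fun_id (f p)]
  conv_lhs => enter [1]; rw [← h]
  rw [← modelDeriv_comp]
  · exact modelDeriv_congr (by
      filter_upwards [f.open_target.mem_nhds (f.map_source hp)] with q hq using f.right_inv hq)
  · rw [h]; exact (contMDiffAt_of_mem_maximalAtlas hf hp).mdifferentiableAt (by simp)
  · exact (contMDiffAt_symm_of_mem_maximalAtlas hf (f.map_source hp)).mdifferentiableAt (by simp)

lemma inverse_modelDeriv_symm (hf : f ∈ IsManifold.maximalAtlas 𝓘(ℝ, E) ∞ M) {p : M}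
    (hp : p ∈ f.source) : (modelDeriv E E f.symm (f p)).inverse = modelDeriv E E f p :=
  ContinuousLinearMap.inverse_eq (modelDeriv_symm_comp hf hp) (modelDeriv_comp_symm hf hp)

lemma isInvertible_modelDeriv (hf : f ∈ IsManifold.maximalAtlas 𝓘(ℝ, E) ∞ M) {p : M}
    (hp : p ∈ f.source) : (modelDeriv E E f p).IsInvertible :=
  ContinuousLinearMap.IsInvertible.of_inverse (modelDeriv_comp_symm hf hp)
    (modelDeriv_symm_comp hf hp)

lemma isInvertible_modelDeriv_symm (hf : f ∈ IsManifold.maximalAtlas 𝓘(ℝ, E) ∞ M) {p : M}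
    (hp : p ∈ f.source) : (modelDeriv E E f.symm (f p)).IsInvertible :=
  ContinuousLinearMap.IsInvertible.of_inverse (modelDeriv_symm_comp hf hp)
    (modelDeriv_comp_symm hf hp)

end ModelDeriv

section LeftInvariant
variable {E : Type*} [NormedAddCommGroup E] [NormedSpace ℝ E]
  {G : Type*} [Group G] [TopologicalSpace G] [ChartedSpace E G]

variable (E) in
/-- The derivative at the identity of the left translation by `p`, which gives the left
trivialisation of the tangent bundle. -/
def leftDeriv (p : G) : E →L[ℝ] E := modelDeriv E E (fun q : G ↦ p * q) 1

/-- The left invariant frame of a Lie group, read in a chart `f`. -/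
def chartFrame (f : OpenPartialHomeomorph G E) (z : E) : E →L[ℝ] E :=
  (modelDeriv E E f (f.symm z)).comp (leftDeriv E (f.symm z))

variable {f : OpenPartialHomeomorph G E}

lemma chartFrame_apply_eq_mpullback (hf : f ∈ IsManifold.maximalAtlas 𝓘(ℝ, E) ∞ G) {z : E}
    (hz : z ∈ f.target) (x : GroupLieAlgebra 𝓘(ℝ, E) G) :
    chartFrame f z x =
      VectorField.mpullback 𝓘(ℝ, E) 𝓘(ℝ, E) f.symm (mulInvariantVectorField x) z := by
  have h := inverse_modelDeriv_symm hf (f.map_target hz)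
  rw [f.right_inv hz] at h
  rw [chartFrame, ← h]
  rfl

variable [LieGroup 𝓘(ℝ, E) ∞ G]

/-- On a smooth Lie group left invariant vector fields are smooth. Mathlib's
`contMDiff_mulInvariantVectorField` is about the smoothness class `minSmoothness ℝ 2` only; the
proof is the same: the field is the derivative of the multiplication applied to a smooth section. -/
lemma contMDiff_infty_mulInvariantVectorField (v : GroupLieAlgebra 𝓘(ℝ, E) G) :
    CMDiff ∞ (T% (mulInvariantVectorField v : Π g : G, TangentSpace 𝓘(ℝ, E) g)) := by
  let fg : G → TangentBundle 𝓘(ℝ, E) G := fun g ↦ TotalSpace.mk' E g 0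
  have sfg : CMDiff ∞ fg := contMDiff_zeroSection _ _
  let fv : G → TangentBundle 𝓘(ℝ, E) G := fun _ ↦ TotalSpace.mk' E 1 v
  have sfv : CMDiff ∞ fv := fun _ ↦ contMDiffAt_const
  let F₁ : G → (TangentBundle 𝓘(ℝ, E) G × TangentBundle 𝓘(ℝ, E) G) := fun g ↦ (fg g, fv g)
  have S₁ : CMDiff ∞ F₁ := sfg.prodMk sfv
  let F₂ : (TangentBundle 𝓘(ℝ, E) G × TangentBundle 𝓘(ℝ, E) G) →
      TangentBundle (𝓘(ℝ, E).prod 𝓘(ℝ, E)) (G × G) :=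
    (equivTangentBundleProd 𝓘(ℝ, E) G 𝓘(ℝ, E) G).symm
  have S₂ : CMDiff ∞ F₂ := contMDiff_equivTangentBundleProd_symm
  let F₃ : TangentBundle (𝓘(ℝ, E).prod 𝓘(ℝ, E)) (G × G) → TangentBundle 𝓘(ℝ, E) G :=
    tangentMap% (fun (p : G × G) ↦ p.1 * p.2)
  have S₃ : CMDiff ∞ F₃ :=
    ContMDiff.contMDiff_tangentMap (n := ∞) (contMDiff_mul 𝓘(ℝ, E) ∞) (m := ∞) le_rfl
  have hS : CMDiff ∞ (fun g ↦ F₃ (F₂ (F₁ g))) := (S₃.comp S₂).comp S₁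
  refine hS.congr fun g ↦ ?_
  have hm : MDifferentiableAt (𝓘(ℝ, E).prod 𝓘(ℝ, E)) 𝓘(ℝ, E) (fun p : G × G ↦ p.1 * p.2) (g, 1) :=
    (contMDiff_mul 𝓘(ℝ, E) ∞).mdifferentiableAt (by simp)
  have h : (mfderiv (𝓘(ℝ, E).prod 𝓘(ℝ, E)) 𝓘(ℝ, E) (fun p : G × G ↦ p.1 * p.2) (g, 1)
      ((0, v) : E × E) : E) = mulInvariantVectorField v g := by
    refine (mfderiv_prod_eq_add_apply hm (v := ((0, v) : E × E))).trans ?_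
    have h1 : (mfderiv 𝓘(ℝ, E) 𝓘(ℝ, E) (fun z : G ↦ z * 1) g : E →L[ℝ] E) 0 = 0 := map_zero _
    let v' : E := mulInvariantVectorField v g
    exact (congrArg (fun w : E ↦ w + v') h1).trans (zero_add _)
  have h2 (a b : G) (hab : a = b) (w w' : E) (hw : w = w') :
      (TotalSpace.mk a w : TangentBundle 𝓘(ℝ, E) G) = TotalSpace.mk b w' := by
    subst hab hw; rfl
  exact h2 g (g * 1) (mul_one g).symm _ _ h.symm

lemma mdifferentiableAt_leftTranslation (g p : G) :
    MDifferentiableAt 𝓘(ℝ, E) 𝓘(ℝ, E) (fun q : G ↦ g * q) p :=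
  (contMDiff_mul_left (I := 𝓘(ℝ, E)) (n := ∞)).mdifferentiableAt (by simp)

lemma leftDeriv_mul (g p : G) :
    leftDeriv E (g * p) = (modelDeriv E E (fun q : G ↦ g * q) p).comp (leftDeriv E p) := by
  have h : (fun q : G ↦ g * p * q) = fun q ↦ g * (p * q) := by
    ext q; exact mul_assoc g p q
  rw [leftDeriv, h, modelDeriv_comp (f := fun q : G ↦ p * q) (g := fun q : G ↦ g * q)
    (mdifferentiableAt_leftTranslation _ _) (mdifferentiableAt_leftTranslation _ _), mul_one]
  rfl

lemma modelDeriv_mul_left_comp (g p : G) :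
    (modelDeriv E E (fun q : G ↦ g⁻¹ * q) (g * p)).comp (modelDeriv E E (fun q : G ↦ g * q) p) =
      ContinuousLinearMap.id ℝ E := by
  rw [← modelDeriv_comp (f := fun q : G ↦ g * q) (g := fun q : G ↦ g⁻¹ * q)
    (mdifferentiableAt_leftTranslation _ _) (mdifferentiableAt_leftTranslation _ _),
      ← modelDeriv_fun_id p]
  congr 1
  ext q
  exact inv_mul_cancel_left g q

lemma modelDeriv_mul_left_comp' (g p : G) :
    (modelDeriv E E (fun q : G ↦ g * q) p).comp (modelDeriv E E (fun q : G ↦ g⁻¹ * q) (g * p)) =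
      ContinuousLinearMap.id ℝ E := by
  simpa using modelDeriv_mul_left_comp g⁻¹ (g * p)

lemma inverse_modelDeriv_mul_left (g p : G) :
    (modelDeriv E E (fun q : G ↦ g * q) p).inverse =
      modelDeriv E E (fun q : G ↦ g⁻¹ * q) (g * p) :=
  ContinuousLinearMap.inverse_eq (modelDeriv_mul_left_comp' g p) (modelDeriv_mul_left_comp g p)

lemma isInvertible_leftDeriv (p : G) : (leftDeriv E p).IsInvertible :=
  ContinuousLinearMap.IsInvertible.of_inverse (modelDeriv_mul_left_comp' p 1)
    (modelDeriv_mul_left_comp p 1)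

/-- Left translation carries a chart at the identity to a chart at `p` with the same left invariant
frame. -/
lemma exists_translated_chart (hf : f ∈ IsManifold.maximalAtlas 𝓘(ℝ, E) ∞ G)
    (h1 : (1 : G) ∈ f.source) (p : G) :
    ∃ f' ∈ IsManifold.maximalAtlas 𝓘(ℝ, E) ∞ G, p ∈ f'.source ∧ f'.target = f.target ∧
      Set.EqOn (chartFrame f') (chartFrame f) f.target := by
  have : IsTopologicalGroup G := topologicalGroup_of_lieGroup 𝓘(ℝ, E) ∞
  let f' := (Homeomorph.mulLeft p⁻¹).toOpenPartialHomeomorph.trans f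
  have hsymm (z : E) : f'.symm z = p * f.symm z := by
    change p⁻¹⁻¹ * f.symm z = p * f.symm z
    rw [inv_inv]
  have hf' : f' ∈ IsManifold.maximalAtlas 𝓘(ℝ, E) ∞ G := by
    refine OpenPartialHomeomorph.mem_maximalAtlas_of_contMDiffOn _ ?_ ?_
    · exact (contMDiffOn_of_mem_maximalAtlas hf).comp
        ((contMDiff_mul_left (I := 𝓘(ℝ, E)) (n := ∞) (a := p⁻¹)).contMDiffOn) fun q hq ↦ hq.2
    · refine ((contMDiff_mul_left (I := 𝓘(ℝ, E)) (n := ∞) (a := p)).comp_contMDiffOn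
        ((contMDiffOn_symm_of_mem_maximalAtlas hf).mono fun q hq ↦ hq.1)).congr fun z _ ↦ hsymm z
  refine ⟨f', hf', ⟨trivial, by simpa using h1⟩, by simp [f'], fun z hz ↦ ?_⟩
  have h2 : modelDeriv E E f' (p * f.symm z) = (modelDeriv E E f (f.symm z)).comp
      (modelDeriv E E (fun q ↦ p⁻¹ * q) (p * f.symm z)) := by
    have := modelDeriv_comp (f := fun q ↦ p⁻¹ * q) (g := f) (p := p * f.symm z)
      (by
        rw [inv_mul_cancel_left]
        exact (contMDiffAt_of_mem_maximalAtlas hf (f.map_target hz)).mdifferentiableAt (by simp))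
      (mdifferentiableAt_leftTranslation _ _)
    rw [inv_mul_cancel_left] at this
    exact this
  rw [chartFrame, hsymm, h2, leftDeriv_mul]
  ext v
  exact congrArg (modelDeriv E E f (f.symm z))
    congr($(modelDeriv_mul_left_comp (E := E) p (f.symm z)) (leftDeriv E (f.symm z) v))

variable [FiniteDimensional ℝ E] [CompleteSpace E]

lemma isSmoothFrameOn_chartFrame (hf : f ∈ IsManifold.maximalAtlas 𝓘(ℝ, E) ∞ G) :
    IsSmoothFrameOn (chartFrame f) f.target where
  isOpen := f.open_target
  contDiffOn := by
    rw [contDiffOn_clm_apply]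
    intro x z hz
    have h1 : (mfderiv 𝓘(ℝ, E) 𝓘(ℝ, E) f.symm z).IsInvertible := by
      have := isInvertible_modelDeriv_symm hf (f.map_target hz)
      rwa [f.right_inv hz] at this
    have h2 := ContMDiffAt.mpullback_vectorField_preimage (m := ∞) (n := ∞)
      ((contMDiff_infty_mulInvariantVectorField (x : GroupLieAlgebra 𝓘(ℝ, E) G)).contMDiffAt)
      (contMDiffAt_symm_of_mem_maximalAtlas hf hz) h1 le_rfl
    have h3 := contMDiffAt_vectorSpace_iff_contDiffAt.1 h2
    exact h3.contDiffWithinAt.congr (fun z hz ↦ chartFrame_apply_eq_mpullback hf hz x)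
      (chartFrame_apply_eq_mpullback hf hz x)
  isInvertible z hz := (isInvertible_modelDeriv hf (f.map_target hz)).comp
    (isInvertible_leftDeriv _)

/-- The fields of the left invariant frame bracket like the elements of the Lie algebra. -/
lemma fderiv_chartFrame_sub (hf : f ∈ IsManifold.maximalAtlas 𝓘(ℝ, E) ∞ G) {z : E}
    (hz : z ∈ f.target) (x y : GroupLieAlgebra 𝓘(ℝ, E) G) :
    fderiv ℝ (chartFrame f) z (chartFrame f z x) y - fderiv ℝ (chartFrame f) z (chartFrame f z y) x
      = chartFrame f z (⁅x, y⁆ : GroupLieAlgebra 𝓘(ℝ, E) G) := by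
  have hX := isSmoothFrameOn_chartFrame hf
  have hd (x v : E) : fderiv ℝ (fun z ↦ chartFrame f z x) z v = fderiv ℝ (chartFrame f) z v x := by
    have : HasFDerivAt (fun z ↦ chartFrame f z x) _ z :=
      (hX.differentiableAt hz).hasFDerivAt.clm_apply (hasFDerivAt_const x z)
    rw [this.fderiv]
    simp
  have hev (x : GroupLieAlgebra 𝓘(ℝ, E) G) :
      (VectorField.mpullback 𝓘(ℝ, E) 𝓘(ℝ, E) f.symm (mulInvariantVectorField x)) =ᶠ[nhds z]
        fun z ↦ chartFrame f z x := by
    filter_upwards [f.open_target.mem_nhds hz] with w hw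
    exact (chartFrame_apply_eq_mpullback hf hw x).symm
  have h := VectorField.mpullback_mlieBracket (n := ∞) (x₀ := z) (f := f.symm)
    (mdifferentiableAt_mulInvariantVectorField x) (mdifferentiableAt_mulInvariantVectorField y)
    (contMDiffAt_symm_of_mem_maximalAtlas hf hz)
    (by rw [minSmoothness_of_isRCLikeNormedField]; norm_cast)
  rw [← mulInvariantVector_mlieBracket, ← GroupLieAlgebra.bracket_def,
    ← chartFrame_apply_eq_mpullback hf hz, ← VectorField.mlieBracketWithin_univ,
    VectorField.mlieBracketWithin_eq_lieBracketWithin] at h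
  refine Eq.trans ?_ (h.trans (congrFun VectorField.lieBracketWithin_univ z)).symm
  have h2 := Filter.EventuallyEq.lieBracket_vectorField_eq (𝕜 := ℝ) (hev x) (hev y)
  refine Eq.trans ?_ h2.symm
  exact congrArg₂ (· - ·) (hd y _).symm (hd x _).symm

end LeftInvariant

/-! ### Structure equations of invariant flat structures -/

section Extraction
variable {E : Type*} [NormedAddCommGroup E] [NormedSpace ℝ E]
  {G : Type*} [Group G] [TopologicalSpace G] [ChartedSpace E G]

/-- The components of a vector field on a Lie group with respect to the left invariant frame. -/
def leftCoord (Y : Π p : G, TangentSpace 𝓘(ℝ, E) p) (p : G) : E := (leftDeriv E p).inverse (Y p)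

lemma leftCoord_add (Y Y' : Π p : G, TangentSpace 𝓘(ℝ, E) p) :
    leftCoord (Y + Y') = leftCoord Y + leftCoord Y' := by
  ext p
  exact map_add (leftDeriv E p).inverse (Y p : E) (Y' p : E)

lemma leftCoord_smul (h : G → ℝ) (Y : Π p : G, TangentSpace 𝓘(ℝ, E) p) :
    leftCoord (h • Y) = h • leftCoord Y := by
  ext p
  exact map_smul (leftDeriv E p).inverse (h p) (Y p : E)

variable [LieGroup 𝓘(ℝ, E) ∞ G] {f : OpenPartialHomeomorph G E}

lemma leftDeriv_leftCoord (Y : Π p : G, TangentSpace 𝓘(ℝ, E) p) (p : G) :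
    leftDeriv E p (leftCoord Y p) = (Y p : E) :=
  (isInvertible_leftDeriv (E := E) p).self_apply_inverse (Y p)

lemma leftCoord_eq_iff {Y : Π p : G, TangentSpace 𝓘(ℝ, E) p} {p : G} {v : E} :
    leftCoord Y p = v ↔ (Y p : E) = leftDeriv E p v := by
  refine ⟨fun h ↦ h ▸ (leftDeriv_leftCoord Y p).symm, fun h ↦ ?_⟩
  exact (isInvertible_leftDeriv (E := E) p).injective ((leftDeriv_leftCoord Y p).trans h)

lemma leftCoord_mulInvariantVectorField (y : GroupLieAlgebra 𝓘(ℝ, E) G) :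
    leftCoord (mulInvariantVectorField y : Π p : G, TangentSpace 𝓘(ℝ, E) p) = fun _ ↦ (y : E) := by
  ext p
  exact leftCoord_eq_iff.2 rfl

lemma mpullback_symm_eq_chartFrame (hf : f ∈ IsManifold.maximalAtlas 𝓘(ℝ, E) ∞ G) {z : E}
    (hz : z ∈ f.target) (Y : Π p : G, TangentSpace 𝓘(ℝ, E) p) :
    (VectorField.mpullback 𝓘(ℝ, E) 𝓘(ℝ, E) f.symm Y z : E) =
      chartFrame f z (leftCoord Y (f.symm z)) := by
  have h := inverse_modelDeriv_symm hf (f.map_target hz)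
  rw [f.right_inv hz] at h
  have h1 : (VectorField.mpullback 𝓘(ℝ, E) 𝓘(ℝ, E) f.symm Y z : E) =
      (modelDeriv E E f.symm z).inverse (Y (f.symm z)) := rfl
  rw [h1, h, ← leftDeriv_leftCoord Y]
  rfl

/-- The flat connection of a chart, in terms of the left invariant frame. -/
lemma pullbackConnection_standardConnection (hf : f ∈ IsManifold.maximalAtlas 𝓘(ℝ, E) ∞ G) {z : E}
    (hz : z ∈ f.target) (Y : Π p : G, TangentSpace 𝓘(ℝ, E) p) (x : E) :
    modelDeriv E E f (f.symm z)
      (pullbackConnection f f.symm (standardConnection E) Y (f.symm z) (leftDeriv E (f.symm z) x)) =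
      fderiv ℝ (fun w ↦ chartFrame f w (leftCoord Y (f.symm w))) z (chartFrame f z x) := by
  have h1 := (isInvertible_modelDeriv hf (f.map_target hz)).self_apply_inverse
    (fderiv ℝ (fun w ↦ (VectorField.mpullback 𝓘(ℝ, E) 𝓘(ℝ, E) f.symm Y w : E)) (f (f.symm z))
      (chartFrame f z x))
  refine Eq.trans h1 ?_
  rw [f.right_inv hz]
  congr 1
  refine Filter.EventuallyEq.fderiv_eq ?_
  filter_upwards [f.open_target.mem_nhds hz] with w hw using mpullback_symm_eq_chartFrame hf hw Y

/-- Left translation of a vector field translates its components. -/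
lemma leftCoord_mpullback_mul (g : G) (Y : Π p : G, TangentSpace 𝓘(ℝ, E) p) (p : G) :
    leftCoord (VectorField.mpullback 𝓘(ℝ, E) 𝓘(ℝ, E) (g⁻¹ * ·) Y) p = leftCoord Y (g⁻¹ * p) := by
  rw [leftCoord_eq_iff]
  have h1 : (VectorField.mpullback 𝓘(ℝ, E) 𝓘(ℝ, E) (g⁻¹ * ·) Y p : E) =
      (modelDeriv E E (fun q : G ↦ g⁻¹ * q) p).inverse (Y (g⁻¹ * p)) := rfl
  have h2 := leftDeriv_mul (E := E) g (g⁻¹ * p)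
  rw [mul_inv_cancel_left] at h2
  have h3 := inverse_modelDeriv_mul_left (E := E) g⁻¹ p
  rw [inv_inv] at h3
  rw [h1, h3, h2, ← leftDeriv_leftCoord Y]
  rfl

lemma pullbackConnection_mul_left (D : ConnectionMap E G) (g p : G)
    (Y : Π p : G, TangentSpace 𝓘(ℝ, E) p) (x : E) :
    modelDeriv E E (fun q : G ↦ g * q) p
      (pullbackConnection (g * ·) (g⁻¹ * ·) D Y p (leftDeriv E p x)) =
    D (VectorField.mpullback 𝓘(ℝ, E) 𝓘(ℝ, E) (g⁻¹ * ·) Y) (g * p) (leftDeriv E (g * p) x) := by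
  have hi : (modelDeriv E E (fun q : G ↦ g * q) p).IsInvertible :=
    ContinuousLinearMap.IsInvertible.of_inverse (modelDeriv_mul_left_comp' g p)
      (modelDeriv_mul_left_comp g p)
  refine Eq.trans (hi.self_apply_inverse _) ?_
  rw [leftDeriv_mul]
  rfl

lemma mdifferentiableAt_invariant (x : GroupLieAlgebra 𝓘(ℝ, E) G) (p : G) :
    MDiffAt (T% (mulInvariantVectorField x : Π g : G, TangentSpace 𝓘(ℝ, E) g)) p :=
  (contMDiff_infty_mulInvariantVectorField x).mdifferentiableAt (by simp)

variable [FiniteDimensional ℝ E] [CompleteSpace E]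

/-- `invariantAction` as a bilinear map. -/
def invariantBilinear (D : CovariantDerivative 𝓘(ℝ, E) E (TangentSpace 𝓘(ℝ, E) : G → Type _)) :
    E →ₗ[ℝ] E →ₗ[ℝ] E :=
  LinearMap.mk₂ ℝ (fun x y ↦ (invariantAction D (x : GroupLieAlgebra 𝓘(ℝ, E) G) y : E))
    (fun x x' y ↦ map_add (D (mulInvariantVectorField (y : GroupLieAlgebra 𝓘(ℝ, E) G)) 1) x x')
    (fun c x y ↦ map_smul (D (mulInvariantVectorField (y : GroupLieAlgebra 𝓘(ℝ, E) G)) 1) c x)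
    (fun x y y' ↦ by
      have h := D.isCovariantDerivativeOnUniv.add
        (mdifferentiableAt_invariant (y : GroupLieAlgebra 𝓘(ℝ, E) G) 1)
        (mdifferentiableAt_invariant (y' : GroupLieAlgebra 𝓘(ℝ, E) G) 1)
      have h' : (mulInvariantVectorField (y + y' : GroupLieAlgebra 𝓘(ℝ, E) G) :
          Π g : G, TangentSpace 𝓘(ℝ, E) g) =
            mulInvariantVectorField y + mulInvariantVectorField y' := by
        ext p
        exact map_add (leftDeriv E p) y y'
      rw [← h'] at h
      exact congr($h x))
    (fun c x y ↦ by
      have h := D.isCovariantDerivativeOnUniv.smul_const c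
        (mdifferentiableAt_invariant (y : GroupLieAlgebra 𝓘(ℝ, E) G) 1)
      have h' : (mulInvariantVectorField (c • y : GroupLieAlgebra 𝓘(ℝ, E) G) :
          Π g : G, TangentSpace 𝓘(ℝ, E) g) = c • mulInvariantVectorField y := by
        ext p
        exact map_smul (leftDeriv E p) c y
      rw [← h'] at h
      exact congr($h x))

variable {D : CovariantDerivative 𝓘(ℝ, E) E (TangentSpace 𝓘(ℝ, E) : G → Type _)}

/-- If `D` agrees with the flat connection of the chart `f` at `p`, and with its own translate under
`p` at the identity, up to the terms defining projective equivalence, then the derivatives at `p` of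
the left invariant frame along itself are given by the values of `D` at the identity. -/
lemma fderiv_chartFrame_eq (hf : f ∈ IsManifold.maximalAtlas 𝓘(ℝ, E) ∞ G) {z : E}
    (hz : z ∈ f.target) {φ : TangentSpace 𝓘(ℝ, E) (f.symm z) →L[ℝ] ℝ}
    {ψ : TangentSpace 𝓘(ℝ, E) (1 : G) →L[ℝ] ℝ}
    (hφ : ∀ Y : Π p : G, TangentSpace 𝓘(ℝ, E) p, MDiffAt (T% Y) (f.symm z) → ∀ v,
      pullbackConnection f f.symm (standardConnection E) Y (f.symm z) v - D Y (f.symm z) v =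
        φ v • Y (f.symm z) + φ (Y (f.symm z)) • v)
    (hψ : ∀ Y : Π p : G, TangentSpace 𝓘(ℝ, E) p, MDiffAt (T% Y) 1 → ∀ v,
      pullbackConnection (f.symm z * ·) ((f.symm z)⁻¹ * ·) D Y 1 v - D Y 1 v =
        ψ v • Y 1 + ψ (Y 1) • v) (x y : E) :
    fderiv ℝ (chartFrame f) z (chartFrame f z x) y = chartFrame f z (invariantBilinear D x y +
      (φ (leftDeriv E (f.symm z) x) + ψ x) • y + (φ (leftDeriv E (f.symm z) y) + ψ y) • x) := by
  let φ' : E →L[ℝ] ℝ := φ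
  let ψ' : E →L[ℝ] ℝ := ψ
  change _ = chartFrame f z (invariantBilinear D x y +
      (φ' (leftDeriv E (f.symm z) x) + ψ' x) • y + (φ' (leftDeriv E (f.symm z) y) + ψ' y) • x)
  have hinv : leftDeriv E (1 : G) = ContinuousLinearMap.id ℝ E := by
    rw [leftDeriv, ← modelDeriv_fun_id (1 : G)]
    simp only [one_mul]
  let Y : Π g : G, TangentSpace 𝓘(ℝ, E) g := mulInvariantVectorField (y : GroupLieAlgebra 𝓘(ℝ, E) G)
  let a₁ : E := pullbackConnection f f.symm (standardConnection E) Y (f.symm z)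
    (leftDeriv E (f.symm z) x)
  let a₂ : E := pullbackConnection ((f.symm z) * ·) ((f.symm z)⁻¹ * ·) D Y 1 x
  let a₃ : E := D Y (f.symm z) (leftDeriv E (f.symm z) x)
  have e1 : a₁ - a₃ = φ' (leftDeriv E (f.symm z) x) • leftDeriv E (f.symm z) y +
        φ' (leftDeriv E (f.symm z) y) • leftDeriv E (f.symm z) x :=
    hφ Y (mdifferentiableAt_invariant y (f.symm z)) (leftDeriv E (f.symm z) x)
  have e2 : a₂ - invariantBilinear D x y =
      ψ' x • leftDeriv E (1 : G) y + ψ' (leftDeriv E (1 : G) y) • x :=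
    hψ Y (mdifferentiableAt_invariant y 1) x
  have e3 := pullbackConnection_mul_left D (f.symm z) 1 Y x
  have e4 := pullbackConnection_standardConnection hf hz Y x
  have e5 : VectorField.mpullback 𝓘(ℝ, E) 𝓘(ℝ, E) ((f.symm z)⁻¹ * ·) Y = Y :=
    mpullback_mulInvariantVectorField _ _
  have e6 : leftCoord Y = fun _ ↦ y := leftCoord_mulInvariantVectorField y
  have e7 : fderiv ℝ (fun w ↦ chartFrame f w y) z (chartFrame f z x) =
      fderiv ℝ (chartFrame f) z (chartFrame f z x) y := by
    have : HasFDerivAt (fun z ↦ chartFrame f z y) _ z :=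
      ((isSmoothFrameOn_chartFrame hf).differentiableAt hz).hasFDerivAt.clm_apply
        (hasFDerivAt_const y z)
    rw [this.fderiv]
    simp
  rw [hinv] at e2 e3
  rw [e5, mul_one] at e3
  rw [e6, e7] at e4
  have e8 := eq_add_of_sub_eq e2
  have e9 := eq_add_of_sub_eq e1
  have e3' : leftDeriv E (f.symm z) a₂ = a₃ := e3
  rw [← e4, chartFrame, ContinuousLinearMap.comp_apply]
  congr 1
  refine e9.trans ?_
  rw [← e3', e8]
  simp only [map_add, map_smul, ContinuousLinearMap.id_apply, add_smul]
  abel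

/-- In a projectively flat chart the left invariant frame has constant derivatives along itself,
up to the terms that define projective equivalence. -/
theorem IsIFPS.exists_fderiv_chartFrame (hD : IsIFPS D) :
    ∃ f ∈ IsManifold.maximalAtlas 𝓘(ℝ, E) ∞ G, (1 : G) ∈ f.source ∧
      ∀ z ∈ f.target, ∃ η : E →ₗ[ℝ] ℝ, ∀ x y, fderiv ℝ (chartFrame f) z (chartFrame f z x) y =
        chartFrame f z (invariantBilinear D x y + η x • y + η y • x) := by
  obtain ⟨f, hf, h1, φ, -, hφ⟩ := hD.flat 1
  refine ⟨f, hf, h1, fun z hz ↦ ?_⟩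
  obtain ⟨ψ, -, hψ⟩ := hD.left_invariant (f.symm z)
  let φ' : E →L[ℝ] ℝ := φ (f.symm z)
  let ψ' : E →L[ℝ] ℝ := ψ 1
  exact ⟨(φ'.comp (leftDeriv E (f.symm z)) + ψ' : E →L[ℝ] ℝ),
    fderiv_chartFrame_eq hf hz (hφ _ (f.map_target hz)) (hψ 1 trivial)⟩

/-- In an affine chart the left invariant frame has constant derivatives along itself. -/
theorem IsIFAS.exists_fderiv_chartFrame (hD : IsIFAS D) :
    ∃ f ∈ IsManifold.maximalAtlas 𝓘(ℝ, E) ∞ G, (1 : G) ∈ f.source ∧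
      ∀ z ∈ f.target, ∀ x y, fderiv ℝ (chartFrame f) z (chartFrame f z x) y =
        chartFrame f z (invariantBilinear D x y) := by
  obtain ⟨f, hf, h1, hφ⟩ := hD.flat 1
  refine ⟨f, hf, h1, fun z hz x y ↦ ?_⟩
  have h := fderiv_chartFrame_eq hf hz (D := D) (φ := 0) (ψ := 0)
    (fun Y hY v ↦ (sub_eq_zero.2 (hφ _ (f.map_target hz) Y hY v)).trans
      (by simp only [zero_apply, zero_smul, add_zero]))
    (fun Y hY v ↦ (sub_eq_zero.2 (hD.left_invariant (f.symm z) 1 trivial Y hY v)).trans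
      (by simp only [zero_apply, zero_smul, add_zero])) x y
  refine h.trans (congrArg (chartFrame f z) ?_)
  change _ + ((0 : ℝ) + 0) • y + ((0 : ℝ) + 0) • x = _
  simp

/-- If the derivatives of the left invariant frame along itself are given by `B` up to projective
equivalence, then the skew part of `B` is the Lie bracket: flatness implies that the connection is
torsion-free. -/
lemma invariantBilinear_sub_of_chart (hf : f ∈ IsManifold.maximalAtlas 𝓘(ℝ, E) ∞ G) {z : E}
    (hz : z ∈ f.target) {B : E →ₗ[ℝ] E →ₗ[ℝ] E} {η : E →ₗ[ℝ] ℝ}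
    (h : ∀ x y, fderiv ℝ (chartFrame f) z (chartFrame f z x) y =
      chartFrame f z (B x y + η x • y + η y • x)) (x y : GroupLieAlgebra 𝓘(ℝ, E) G) :
    (B x y - B y x : E) = (⁅x, y⁆ : GroupLieAlgebra 𝓘(ℝ, E) G) := by
  have hX := isSmoothFrameOn_chartFrame hf
  refine hX.injective hz ?_
  rw [← fderiv_chartFrame_sub hf hz]
  refine Eq.trans ?_ (congrArg₂ (· - ·) (h x y).symm (h y x).symm)
  simp only [← map_sub]
  congr 1
  abel

/-- A reducible invariant connection, in terms of the linear form `α` with kernel `𝔥'` and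
`α e = 1`. -/
lemma IsReducible.exists_linearForm (hD : IsReducible D) : ∃ (α : E →L[ℝ] ℝ) (e : E), α e = 1 ∧
    (∀ x, invariantBilinear D x e = α x • invariantBilinear D e e) ∧
    ∀ x y, α y = 0 → α (invariantBilinear D x y) = 0 := by
  obtain ⟨𝔞, 𝔥', hc, h1, ha, hh⟩ := hD
  let A : Submodule ℝ E := 𝔞.toSubmodule
  let H : Submodule ℝ E := 𝔥'.toSubmodule
  have hc : IsCompl A H := hc
  have h1 : Module.finrank ℝ A = 1 := h1
  have ha : ∀ y ∈ H, ∀ a ∈ A, invariantBilinear D y a = 0 := ha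
  have hh : ∀ x, ∀ y ∈ H, invariantBilinear D x y ∈ H := hh
  let j : A ≃ₗ[ℝ] ℝ := LinearEquiv.ofFinrankEq A ℝ (by rw [h1, Module.finrank_self])
  let α : E →ₗ[ℝ] ℝ := j.toLinearMap ∘ₗ A.projectionOnto H hc
  have hα (y : E) : α y = 0 ↔ y ∈ H := by
    simp [α]
  let e : E := (j.symm 1 : A)
  have heα : α e = 1 := by
    simp [α, e]
  refine ⟨LinearMap.toContinuousLinearMap α, e, heα, fun x ↦ ?_, fun x y hy ↦
    (hα _).2 (hh x y ((hα y).1 hy))⟩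
  have hx : x - α x • e ∈ H := (hα _).1 (by rw [map_sub, map_smul, heα, smul_eq_mul, mul_one,
    sub_self])
  have h := ha _ hx e (j.symm 1 : A).2
  rwa [map_sub, map_smul, LinearMap.sub_apply, LinearMap.smul_apply, sub_eq_zero] at h

end Extraction

/-! ### Products of Lie groups -/

section Product
variable {E₁ : Type*} [NormedAddCommGroup E₁] [NormedSpace ℝ E₁]
  {E₂ : Type*} [NormedAddCommGroup E₂] [NormedSpace ℝ E₂]
  {M₁ : Type*} [TopologicalSpace M₁] [ChartedSpace E₁ M₁]
  {M₂ : Type*} [TopologicalSpace M₂] [ChartedSpace E₂ M₂]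
  {N₁ : Type*} [TopologicalSpace N₁] [ChartedSpace E₁ N₁]
  {N₂ : Type*} [TopologicalSpace N₂] [ChartedSpace E₂ N₂]
  {L : Type*} [Group L] [TopologicalSpace L] [ChartedSpace E₁ L] [LieGroup 𝓘(ℝ, E₁) ∞ L]
  {H : Type*} [Group H] [TopologicalSpace H] [ChartedSpace E₂ H] [LieGroup 𝓘(ℝ, E₂) ∞ H]

/-- The product of two manifolds modelled on vector spaces, modelled on the product vector space.
The instance `prodChartedSpace` has the type synonym `ModelProd E₁ E₂` as its model. The priority is
low because on `E₁ × E₂` itself the instance `chartedSpaceSelf` is preferred; the two agree by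
`chartedSpaceSelf_prod`. -/
instance (priority := low) prodVectorChartedSpace : ChartedSpace (E₁ × E₂) (M₁ × M₂) :=
  prodChartedSpace E₁ M₁ E₂ M₂

instance lieGroup_prod : LieGroup 𝓘(ℝ, E₁ × E₂) ∞ (L × H) := by
  have h : LieGroup (𝓘(ℝ, E₁).prod 𝓘(ℝ, E₂)) ∞ (L × H) := inferInstance
  have e := modelWithCornersSelf_prod (𝕜 := ℝ) (E := E₁) (F := E₂)
  rw [← e] at h
  exact h

lemma modelDeriv_prodMap {f₁ : M₁ → N₁} {f₂ : M₂ → N₂} {p : M₁ × M₂}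
    (h₁ : MDifferentiableAt 𝓘(ℝ, E₁) 𝓘(ℝ, E₁) f₁ p.1)
    (h₂ : MDifferentiableAt 𝓘(ℝ, E₂) 𝓘(ℝ, E₂) f₂ p.2) :
    modelDeriv (E₁ × E₂) (E₁ × E₂) (Prod.map f₁ f₂) p =
      (modelDeriv E₁ E₁ f₁ p.1).prodMap (modelDeriv E₂ E₂ f₂ p.2) := by
  have h := mfderiv_prodMap h₁ h₂
  exact h

lemma leftDeriv_prod (p : L × H) :
    leftDeriv (E₁ × E₂) p = (leftDeriv E₁ p.1).prodMap (leftDeriv E₂ p.2) :=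
  modelDeriv_prodMap (p := (1, 1)) (mdifferentiableAt_leftTranslation p.1 1)
    (mdifferentiableAt_leftTranslation p.2 1)

variable {f₁ : OpenPartialHomeomorph L E₁} {f₂ : OpenPartialHomeomorph H E₂}

lemma prodChart_mem_maximalAtlas (h₁ : f₁ ∈ IsManifold.maximalAtlas 𝓘(ℝ, E₁) ∞ L)
    (h₂ : f₂ ∈ IsManifold.maximalAtlas 𝓘(ℝ, E₂) ∞ H) :
    f₁.prod f₂ ∈ IsManifold.maximalAtlas 𝓘(ℝ, E₁ × E₂) ∞ (L × H) := by
  have h := IsManifold.mem_maximalAtlas_prod h₁ h₂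
  rw [← modelWithCornersSelf_prod] at h
  exact h

lemma chartFrame_prod (h₁ : f₁ ∈ IsManifold.maximalAtlas 𝓘(ℝ, E₁) ∞ L)
    (h₂ : f₂ ∈ IsManifold.maximalAtlas 𝓘(ℝ, E₂) ∞ H) {z : E₁ × E₂} (hz : z ∈ (f₁.prod f₂).target) :
    chartFrame (f₁.prod f₂) z = prodFrame (chartFrame f₁) (chartFrame f₂) z := by
  have e : modelDeriv (E₁ × E₂) (E₁ × E₂) (f₁.prod f₂) ((f₁.prod f₂).symm z) =
      (modelDeriv E₁ E₁ f₁ (f₁.symm z.1)).prodMap (modelDeriv E₂ E₂ f₂ (f₂.symm z.2)) := by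
    have h := modelDeriv_prodMap (p := (f₁.prod f₂).symm z)
      ((contMDiffAt_of_mem_maximalAtlas h₁ (f₁.map_target hz.1)).mdifferentiableAt (by simp))
      ((contMDiffAt_of_mem_maximalAtlas h₂ (f₂.map_target hz.2)).mdifferentiableAt (by simp))
    have e : (prodVectorChartedSpace : ChartedSpace (E₁ × E₂) (E₁ × E₂)) =
      chartedSpaceSelf (E₁ × E₂) := chartedSpaceSelf_prod
    rw [e] at h
    exact h
  rw [chartFrame, e, leftDeriv_prod]
  rfl

lemma fderiv_prodFrame {V₁ V₂ : Type*} [NormedAddCommGroup V₁] [NormedSpace ℝ V₁]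
    [NormedAddCommGroup V₂] [NormedSpace ℝ V₂] {X₁ : E₁ → V₁ →L[ℝ] E₁} {X₂ : E₂ → V₂ →L[ℝ] E₂}
    {z : E₁ × E₂} (h : DifferentiableAt ℝ (prodFrame X₁ X₂) z) (h₁ : DifferentiableAt ℝ X₁ z.1)
    (h₂ : DifferentiableAt ℝ X₂ z.2) (v : E₁ × E₂) (y : V₁ × V₂) :
    fderiv ℝ (prodFrame X₁ X₂) z v y = (fderiv ℝ X₁ z.1 v.1 y.1, fderiv ℝ X₂ z.2 v.2 y.2) := by
  have e1 : HasFDerivAt (fun p ↦ prodFrame X₁ X₂ p y) _ z :=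
    h.hasFDerivAt.clm_apply (hasFDerivAt_const y z)
  have e2 : HasFDerivAt (fun p : E₁ × E₂ ↦ (X₁ p.1 y.1, X₂ p.2 y.2)) _ z :=
    ((h₁.hasFDerivAt.comp z hasFDerivAt_fst).clm_apply (hasFDerivAt_const y.1 z)).prodMk
      ((h₂.hasFDerivAt.comp z hasFDerivAt_snd).clm_apply (hasFDerivAt_const y.2 z))
  have e3 := congr($(e1.unique e2) v)
  simpa using e3

variable [FiniteDimensional ℝ E₁] [CompleteSpace E₁] [FiniteDimensional ℝ E₂] [CompleteSpace E₂]

/-- The element of the Lie algebra of a product of two Lie groups with the given components. -/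
def groupLieAlgebraProdMk (x₁ : GroupLieAlgebra 𝓘(ℝ, E₁) L) (x₂ : GroupLieAlgebra 𝓘(ℝ, E₂) H) :
    GroupLieAlgebra 𝓘(ℝ, E₁ × E₂) (L × H) := ((x₁, x₂) : E₁ × E₂)

/-- The bracket is read off from the derivatives of the frame of a product chart. -/
lemma groupLieAlgebra_prod_bracket (x₁ y₁ : GroupLieAlgebra 𝓘(ℝ, E₁) L)
    (x₂ y₂ : GroupLieAlgebra 𝓘(ℝ, E₂) H) :
    ⁅groupLieAlgebraProdMk x₁ x₂, groupLieAlgebraProdMk y₁ y₂⁆ =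
      groupLieAlgebraProdMk ⁅x₁, y₁⁆ ⁅x₂, y₂⁆ := by
  have h₁ : chartAt E₁ (1 : L) ∈ IsManifold.maximalAtlas 𝓘(ℝ, E₁) ∞ L :=
    IsManifold.chart_mem_maximalAtlas 1
  have h₂ : chartAt E₂ (1 : H) ∈ IsManifold.maximalAtlas 𝓘(ℝ, E₂) ∞ H :=
    IsManifold.chart_mem_maximalAtlas 1
  have h := prodChart_mem_maximalAtlas h₁ h₂
  have hX := isSmoothFrameOn_chartFrame h
  have hX₁ := isSmoothFrameOn_chartFrame h₁
  have hX₂ := isSmoothFrameOn_chartFrame h₂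
  set z : E₁ × E₂ := (chartAt E₁ (1 : L) 1, chartAt E₂ (1 : H) 1)
  have hz₁ : z.1 ∈ (chartAt E₁ (1 : L)).target := mem_chart_target _ _
  have hz₂ : z.2 ∈ (chartAt E₂ (1 : H)).target := mem_chart_target _ _
  have hz : z ∈ ((chartAt E₁ (1 : L)).prod (chartAt E₂ (1 : H))).target := ⟨hz₁, hz₂⟩
  refine hX.injective hz ?_
  refine (fderiv_chartFrame_sub h hz _ _).symm.trans ?_
  have he : chartFrame ((chartAt E₁ (1 : L)).prod (chartAt E₂ (1 : H))) =ᶠ[nhds z]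
      prodFrame (chartFrame (chartAt E₁ (1 : L))) (chartFrame (chartAt E₂ (1 : H))) := by
    filter_upwards [hX.isOpen.mem_nhds hz] with w hw using chartFrame_prod h₁ h₂ hw
  have hd := he.differentiableAt_iff.1 (hX.differentiableAt hz)
  rw [he.fderiv_eq, he.self_of_nhds]
  have e := fderiv_prodFrame hd (hX₁.differentiableAt hz₁) (hX₂.differentiableAt hz₂)
  refine (congrArg₂ (· - ·) (e _ _) (e _ _)).trans ?_
  exact Prod.ext (fderiv_chartFrame_sub h₁ hz₁ x₁ y₁) (fderiv_chartFrame_sub h₂ hz₂ x₂ y₂)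

end Product

/-- The product of two Lie groups with given Lie algebras. -/
def LieGroupOf.prod {𝔩 : Type*} [LieRing 𝔩] [LieAlgebra ℝ 𝔩] {𝔥 : Type*} [LieRing 𝔥]
    [LieAlgebra ℝ 𝔥] (L : LieGroupOf 𝔩) (H : LieGroupOf 𝔥) : LieGroupOf (𝔩 × 𝔥) where
  E := L.E × H.E
  G := L.G × H.G
  lieEquiv :=
    { toFun := fun a ↦ groupLieAlgebraProdMk (L.lieEquiv a.1) (H.lieEquiv a.2)
      map_add' := fun a b ↦ Prod.ext (map_add L.lieEquiv a.1 b.1) (map_add H.lieEquiv a.2 b.2)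
      map_smul' := fun c a ↦ Prod.ext (map_smul L.lieEquiv c a.1) (map_smul H.lieEquiv c a.2)
      map_lie' := fun {a b} ↦ by
        refine Eq.trans ?_ (groupLieAlgebra_prod_bracket _ _ _ _).symm
        exact congrArg₂ groupLieAlgebraProdMk (LieEquiv.map_lie L.lieEquiv a.1 b.1)
          (LieEquiv.map_lie H.lieEquiv a.2 b.2)
      invFun := fun v ↦ (L.lieEquiv.symm (v : L.E × H.E).1, H.lieEquiv.symm (v : L.E × H.E).2)
      left_inv := fun a ↦ Prod.ext (L.lieEquiv.symm_apply_apply a.1)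
        (H.lieEquiv.symm_apply_apply a.2)
      right_inv := fun v ↦ Prod.ext (L.lieEquiv.apply_symm_apply (v : L.E × H.E).1)
        (H.lieEquiv.apply_symm_apply (v : L.E × H.E).2) }

/-! ### Left invariant connections -/

section Connection
variable {E : Type*} [NormedAddCommGroup E] [NormedSpace ℝ E]
  {G : Type*} [Group G] [TopologicalSpace G] [ChartedSpace E G] [LieGroup 𝓘(ℝ, E) ∞ G]

/-- The operation of the left invariant connection given by a bilinear map `S`: the derivative of
the components with respect to the left invariant frame, plus `S`. -/
def leftInvariantConnectionMap (S : E →L[ℝ] E →L[ℝ] E) : ConnectionMap E G := fun Y p ↦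
  (leftDeriv E p).comp (modelDeriv E E (leftCoord Y) p +
    (S.flip (leftCoord Y p)).comp (leftDeriv E p).inverse)

lemma leftInvariantConnectionMap_apply (S : E →L[ℝ] E →L[ℝ] E)
    (Y : Π p : G, TangentSpace 𝓘(ℝ, E) p) (p : G) (x : E) :
    leftInvariantConnectionMap S Y p (leftDeriv E p x) = (leftDeriv E p
      (modelDeriv E E (leftCoord Y) p (leftDeriv E p x) + S x (leftCoord Y p)) : E) := by
  have h : (leftDeriv E p).inverse (leftDeriv E p x) = x :=
    (isInvertible_leftDeriv p).inverse_apply_self x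
  refine Eq.trans (b := leftDeriv E p (modelDeriv E E (leftCoord Y) p (leftDeriv E p x) +
    S ((leftDeriv E p).inverse (leftDeriv E p x)) (leftCoord Y p))) rfl ?_
  rw [h]

variable [FiniteDimensional ℝ E] [CompleteSpace E] {f : OpenPartialHomeomorph G E}

lemma leftCoord_comp_symm_eq (hf : f ∈ IsManifold.maximalAtlas 𝓘(ℝ, E) ∞ G) {z : E}
    (hz : z ∈ f.target) (Y : Π p : G, TangentSpace 𝓘(ℝ, E) p) :
    leftCoord Y (f.symm z) = (chartFrame f z).inverse
      (VectorField.mpullback 𝓘(ℝ, E) 𝓘(ℝ, E) f.symm Y z : E) := by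
  refine Eq.trans ?_ (congrArg (chartFrame f z).inverse (mpullback_symm_eq_chartFrame hf hz Y).symm)
  rw [(isSmoothFrameOn_chartFrame hf).inverse_apply hz]

lemma differentiableAt_leftCoord (hf : f ∈ IsManifold.maximalAtlas 𝓘(ℝ, E) ∞ G) {z : E}
    (hz : z ∈ f.target) {Y : Π p : G, TangentSpace 𝓘(ℝ, E) p} (hY : MDiffAt (T% Y) (f.symm z)) :
    DifferentiableAt ℝ (fun w ↦ leftCoord Y (f.symm w)) z := by
  have hX := isSmoothFrameOn_chartFrame hf
  have h1 : (mfderiv 𝓘(ℝ, E) 𝓘(ℝ, E) f.symm z).IsInvertible := by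
    have := isInvertible_modelDeriv_symm hf (f.map_target hz)
    rwa [f.right_inv hz] at this
  have h2 := MDifferentiableAt.mpullback_vectorField (n := ∞) hY
    (contMDiffAt_symm_of_mem_maximalAtlas hf hz) h1 (by norm_cast)
  have h3 := (((contMDiff_snd_tangentBundle_modelSpace (n := ∞) E 𝓘(ℝ, E)).contMDiffAt
    |>.mdifferentiableAt (by simp)).comp z h2).differentiableAt
  have h4 : DifferentiableAt ℝ (fun w ↦ (chartFrame f w).inverse) z :=
    differentiableAt_of_contDiffOn hX.isOpen hX.contDiffOn_inverse hz
  refine (h4.clm_apply h3).congr_of_eventuallyEq ?_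
  filter_upwards [f.open_target.mem_nhds hz] with w hw using leftCoord_comp_symm_eq hf hw Y

lemma contDiffAt_leftCoord (hf : f ∈ IsManifold.maximalAtlas 𝓘(ℝ, E) ∞ G) {z : E}
    (hz : z ∈ f.target) {Y : Π p : G, TangentSpace 𝓘(ℝ, E) p} (hY : CMDiffAt ∞ (T% Y) (f.symm z)) :
    ContDiffAt ℝ ∞ (fun w ↦ leftCoord Y (f.symm w)) z := by
  have hX := isSmoothFrameOn_chartFrame hf
  have h1 : (mfderiv 𝓘(ℝ, E) 𝓘(ℝ, E) f.symm z).IsInvertible := by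
    have := isInvertible_modelDeriv_symm hf (f.map_target hz)
    rwa [f.right_inv hz] at this
  have h2 := ContMDiffAt.mpullback_vectorField_preimage (m := ∞) (n := ∞) hY
    (contMDiffAt_symm_of_mem_maximalAtlas hf hz) h1 le_rfl
  have h3 := contMDiffAt_vectorSpace_iff_contDiffAt.1 h2
  have h4 : ContDiffAt ℝ ∞ (fun w ↦ (chartFrame f w).inverse) z :=
    hX.contDiffOn_inverse.contDiffAt (hX.isOpen.mem_nhds hz)
  refine (h4.clm_apply h3).congr_of_eventuallyEq ?_
  filter_upwards [f.open_target.mem_nhds hz] with w hw using leftCoord_comp_symm_eq hf hw Y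

lemma mdifferentiableAt_leftCoord {p : G} {Y : Π p : G, TangentSpace 𝓘(ℝ, E) p}
    (hY : MDiffAt (T% Y) p) : MDifferentiableAt 𝓘(ℝ, E) 𝓘(ℝ, E) (leftCoord Y) p := by
  let f := chartAt E p
  have hf : f ∈ IsManifold.maximalAtlas 𝓘(ℝ, E) ∞ G := IsManifold.chart_mem_maximalAtlas p
  have hp : p ∈ f.source := mem_chart_source E p
  have h := differentiableAt_leftCoord hf (f.map_source hp) (Y := Y)
    (by rwa [f.left_inv hp])
  have h2 := h.mdifferentiableAt.comp p
    ((contMDiffAt_of_mem_maximalAtlas hf hp).mdifferentiableAt (by simp))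
  refine h2.congr_of_eventuallyEq ?_
  filter_upwards [f.open_source.mem_nhds hp] with q hq
  simp only [Function.comp_apply, f.left_inv hq]

/-- The left invariant connection given by a bilinear map. -/
def leftInvariantConnection (S : E →L[ℝ] E →L[ℝ] E) :
    CovariantDerivative 𝓘(ℝ, E) E (TangentSpace 𝓘(ℝ, E) : G → Type _) where
  toFun := leftInvariantConnectionMap S
  isCovariantDerivativeOnUniv :=
    { add := fun {Y Y' p} hY hY' _ ↦ by
        have h : modelDeriv E E (leftCoord Y + leftCoord Y') p =
            modelDeriv E E (leftCoord Y) p + modelDeriv E E (leftCoord Y') p :=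
          mvfderiv_add (F := E) (mdifferentiableAt_leftCoord hY) (mdifferentiableAt_leftCoord hY')
        have h2 : (leftDeriv E p).comp (modelDeriv E E (leftCoord (Y + Y')) p +
            (S.flip (leftCoord (Y + Y') p)).comp (leftDeriv E p).inverse) =
            (leftDeriv E p).comp (modelDeriv E E (leftCoord Y) p +
              (S.flip (leftCoord Y p)).comp (leftDeriv E p).inverse) +
            (leftDeriv E p).comp (modelDeriv E E (leftCoord Y') p +
              (S.flip (leftCoord Y' p)).comp (leftDeriv E p).inverse) := by
          rw [leftCoord_add, h, Pi.add_apply]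
          ext v
          simp
          abel
        exact h2
      leibniz := fun {Y g p} hY hg _ ↦ by
        have h : modelDeriv E E (g • leftCoord Y) p =
            g p • modelDeriv E E (leftCoord Y) p +
              (modelDeriv E ℝ g p).smulRight (leftCoord Y p) :=
          mvfderiv_smul (F := E) hg (mdifferentiableAt_leftCoord hY)
        have h2 : (leftDeriv E p).comp (modelDeriv E E (leftCoord (g • Y)) p +
            (S.flip (leftCoord (g • Y) p)).comp (leftDeriv E p).inverse) =
            g p • (leftDeriv E p).comp (modelDeriv E E (leftCoord Y) p +
              (S.flip (leftCoord Y p)).comp (leftDeriv E p).inverse) +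
            (modelDeriv E ℝ g p).smulRight (leftDeriv E p (leftCoord Y p)) := by
          rw [leftCoord_smul, h, Pi.smul_apply']
          ext v
          simp
          module
        rw [leftDeriv_leftCoord] at h2
        exact h2 }

variable {S : E →L[ℝ] E →L[ℝ] E}

/-- Torsion is a tensor, hence is determined by its values on left invariant fields. -/
lemma leftInvariantConnection_torsion
    (hS : ∀ x y : GroupLieAlgebra 𝓘(ℝ, E) G, (S x y - S y x : E) = ⁅x, y⁆) :
    (leftInvariantConnection S : CovariantDerivative 𝓘(ℝ, E) E
      (TangentSpace 𝓘(ℝ, E) : G → Type _)).torsion = 0 := by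
  have key (p : G) (x y : GroupLieAlgebra 𝓘(ℝ, E) G) :
      (leftInvariantConnection S).torsion p (mulInvariantVectorField x p)
        (mulInvariantVectorField y p) = 0 := by
    rw [CovariantDerivative.torsion_apply _ (mdifferentiableAt_invariant x p)
      (mdifferentiableAt_invariant y p)]
    have e (x y : E) :
        (leftInvariantConnectionMap S (mulInvariantVectorField (y : GroupLieAlgebra 𝓘(ℝ, E) G)) p
          (leftDeriv E p x) : E) = leftDeriv E p (S x y) := by
      let Y : Π p : G, TangentSpace 𝓘(ℝ, E) p :=
        mulInvariantVectorField (y : GroupLieAlgebra 𝓘(ℝ, E) G)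
      have hY : leftCoord Y = fun _ ↦ y := leftCoord_mulInvariantVectorField y
      have h0 : modelDeriv E E (fun _ : G ↦ y) p = 0 := mfderiv_const
      refine (leftInvariantConnectionMap_apply S Y p x).trans ?_
      rw [hY, h0, zero_apply, zero_add]
    have e3 : (VectorField.mlieBracket 𝓘(ℝ, E) (mulInvariantVectorField x)
        (mulInvariantVectorField y) p : E) = leftDeriv E p (⁅x, y⁆ : GroupLieAlgebra 𝓘(ℝ, E) G) :=
      (congrFun (mulInvariantVector_mlieBracket x y) p).symm
    refine (congrArg₂ (· - ·) (congrArg₂ (· - ·) (e x y) (e y x)) e3).trans ?_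
    have h : leftDeriv E p (S x y) - leftDeriv E p (S y x) -
        leftDeriv E p (⁅x, y⁆ : GroupLieAlgebra 𝓘(ℝ, E) G) = 0 := by
      rw [← hS, map_sub, sub_self]
    exact h
  ext p u v
  have h (u : E) : leftDeriv E p ((leftDeriv E p).inverse u) = u :=
    (isInvertible_leftDeriv p).self_apply_inverse u
  have hk := key p ((leftDeriv E p).inverse u) ((leftDeriv E p).inverse v)
  have hu : (mulInvariantVectorField ((leftDeriv E p).inverse u : GroupLieAlgebra 𝓘(ℝ, E) G) p :
    TangentSpace 𝓘(ℝ, E) p) = u := h u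
  have hv : (mulInvariantVectorField ((leftDeriv E p).inverse v : GroupLieAlgebra 𝓘(ℝ, E) G) p :
    TangentSpace 𝓘(ℝ, E) p) = v := h v
  rw [hu, hv] at hk
  exact hk

lemma leftInvariantConnection_left_invariant (S : E →L[ℝ] E →L[ℝ] E) (g : G) :
    ConnectionEqOn Set.univ
      (pullbackConnection (g * ·) (g⁻¹ * ·) (leftInvariantConnectionMap (G := G) S))
      (leftInvariantConnectionMap S) := by
  intro p _ Y hY v
  obtain ⟨x, rfl⟩ : ∃ x : E, leftDeriv E p x = v :=
    ⟨_, (isInvertible_leftDeriv (E := E) p).self_apply_inverse v⟩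
  have hinj : Function.Injective (modelDeriv E E (fun q : G ↦ g * q) p) :=
    Function.LeftInverse.injective (fun v ↦ congr($(modelDeriv_mul_left_comp (E := E) g p) v))
  refine hinj ?_
  refine (pullbackConnection_mul_left (leftInvariantConnectionMap S) g p Y x).trans ?_
  refine (leftInvariantConnectionMap_apply S _ (g * p) x).trans ?_
  have h1 : leftCoord (VectorField.mpullback 𝓘(ℝ, E) 𝓘(ℝ, E) (g⁻¹ * ·) Y) =
      fun q ↦ leftCoord Y (g⁻¹ * q) := funext (leftCoord_mpullback_mul g Y)
  have h2 : modelDeriv E E (fun q ↦ leftCoord Y (g⁻¹ * q)) (g * p) =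
      (modelDeriv E E (leftCoord Y) p).comp (modelDeriv E E (fun q : G ↦ g⁻¹ * q) (g * p)) := by
    have h := modelDeriv_comp (f := fun q : G ↦ g⁻¹ * q) (g := leftCoord Y) (p := g * p)
      (by rw [inv_mul_cancel_left]; exact mdifferentiableAt_leftCoord hY)
      (mdifferentiableAt_leftTranslation _ _)
    rwa [inv_mul_cancel_left] at h
  have h3 : modelDeriv E E (fun q : G ↦ g⁻¹ * q) (g * p) (leftDeriv E (g * p) x) =
      leftDeriv E p x := by
    rw [leftDeriv_mul]
    exact congr($(modelDeriv_mul_left_comp (E := E) g p) (leftDeriv E p x))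
  have h4 : (fun q ↦ leftCoord Y (g⁻¹ * q)) (g * p) = leftCoord Y p :=
    congrArg (leftCoord Y) (inv_mul_cancel_left g p)
  rw [h1, h2, ContinuousLinearMap.comp_apply, h3, h4, leftDeriv_mul]
  exact congrArg (modelDeriv E E (fun q : G ↦ g * q) p)
    (leftInvariantConnectionMap_apply S Y p x).symm

/-- A chart is affine for the left invariant connection given by `S` as soon as, in this chart, the
derivatives of the left invariant frame along itself are given by `S`. -/
lemma connectionEqOn_leftInvariantConnection (hf : f ∈ IsManifold.maximalAtlas 𝓘(ℝ, E) ∞ G)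
    (h : ∀ z ∈ f.target, ∀ x y, fderiv ℝ (chartFrame f) z (chartFrame f z x) y =
      chartFrame f z (S x y)) :
    ConnectionEqOn f.source (pullbackConnection f f.symm (standardConnection E))
      (leftInvariantConnectionMap S) := by
  intro p hp Y hY v
  obtain ⟨x, rfl⟩ : ∃ x : E, leftDeriv E p x = v :=
    ⟨_, (isInvertible_leftDeriv (E := E) p).self_apply_inverse v⟩
  obtain ⟨z, hz, rfl⟩ : ∃ z ∈ f.target, f.symm z = p := ⟨f p, f.map_source hp, f.left_inv hp⟩
  have hX := isSmoothFrameOn_chartFrame hf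
  have hinj : Function.Injective (modelDeriv E E f (f.symm z)) := by
    obtain ⟨e, he⟩ := isInvertible_modelDeriv hf hp
    rw [← he]
    exact e.injective
  refine hinj ?_
  refine (pullbackConnection_standardConnection hf hz Y x).trans ?_
  have h1 : modelDeriv E E (fun w ↦ leftCoord Y (f.symm w)) z =
      (modelDeriv E E (leftCoord Y) (f.symm z)).comp (modelDeriv E E f.symm z) :=
    modelDeriv_comp (g := leftCoord Y) (mdifferentiableAt_leftCoord hY)
      ((contMDiffAt_symm_of_mem_maximalAtlas hf hz).mdifferentiableAt (by simp))
  have h2 : modelDeriv E E f.symm z (chartFrame f z x) = leftDeriv E (f.symm z) x := by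
    have e := modelDeriv_symm_comp hf hp
    rw [f.right_inv hz] at e
    exact congr($e (leftDeriv E (f.symm z) x))
  have h3 : HasFDerivAt (fun w ↦ chartFrame f w (leftCoord Y (f.symm w))) _ z :=
    (hX.differentiableAt hz).hasFDerivAt.clm_apply
      (differentiableAt_leftCoord hf hz hY).hasFDerivAt
  rw [h3.fderiv, ← modelDeriv_eq_fderiv (fun w ↦ leftCoord Y (f.symm w)), h1]
  simp only [_root_.add_apply, ContinuousLinearMap.comp_apply, ContinuousLinearMap.flip_apply,
    h z hz, h2, ← map_add]
  exact congrArg (modelDeriv E E f (f.symm z)) (leftInvariantConnectionMap_apply S Y _ x).symm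

/-- The left invariant connection in a chart. -/
lemma leftInvariantConnectionMap_eq_comp (hf : f ∈ IsManifold.maximalAtlas 𝓘(ℝ, E) ∞ G) {z : E}
    (hz : z ∈ f.target) {Y : Π p : G, TangentSpace 𝓘(ℝ, E) p} (hY : MDiffAt (T% Y) (f.symm z))
    (v : E) :
    modelDeriv E E f (f.symm z) (leftInvariantConnectionMap S Y (f.symm z)
      (modelDeriv E E f.symm z v)) = chartFrame f z (fderiv ℝ (fun w ↦ leftCoord Y (f.symm w)) z v +
        S ((chartFrame f z).inverse v) (leftCoord Y (f.symm z))) := by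
  have hp := f.map_target hz
  obtain ⟨x, rfl⟩ := (isSmoothFrameOn_chartFrame hf).surjective hz v
  have h1 : modelDeriv E E (fun w ↦ leftCoord Y (f.symm w)) z =
      (modelDeriv E E (leftCoord Y) (f.symm z)).comp (modelDeriv E E f.symm z) :=
    modelDeriv_comp (g := leftCoord Y) (mdifferentiableAt_leftCoord hY)
      ((contMDiffAt_symm_of_mem_maximalAtlas hf hz).mdifferentiableAt (by simp))
  have h2 : modelDeriv E E f.symm z (chartFrame f z x) = leftDeriv E (f.symm z) x := by
    have e := modelDeriv_symm_comp hf hp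
    rw [f.right_inv hz] at e
    exact congr($e (leftDeriv E (f.symm z) x))
  rw [(isSmoothFrameOn_chartFrame hf).inverse_apply hz, ← modelDeriv_eq_fderiv, h1,
    ContinuousLinearMap.comp_apply, h2]
  exact congrArg (modelDeriv E E f (f.symm z)) (leftInvariantConnectionMap_apply S Y _ x)

lemma leftInvariantConnection_contMDiff (S : E →L[ℝ] E →L[ℝ] E) :
    (leftInvariantConnection S : CovariantDerivative 𝓘(ℝ, E) E
      (TangentSpace 𝓘(ℝ, E) : G → Type _)).ContMDiffCovariantDerivative ∞ where
  contMDiff :=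
    { contMDiff := fun {Y} hY p _ ↦ by
        rw [contMDiffWithinAt_univ]
        have hY : CMDiff ∞ (T% Y) := contMDiffOn_univ.1 hY
        let f := chartAt E p
        have hf : f ∈ IsManifold.maximalAtlas 𝓘(ℝ, E) ∞ G := IsManifold.chart_mem_maximalAtlas p
        have hp : p ∈ f.source := mem_chart_source E p
        have hz := f.map_source hp
        have hX := isSmoothFrameOn_chartFrame hf
        rw [contMDiffAt_hom_bundle]
        refine ⟨contMDiffAt_id, ?_⟩
        let F : E → E →L[ℝ] E := fun z ↦ (chartFrame f z).comp
          (fderiv ℝ (fun w ↦ leftCoord Y (f.symm w)) z +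
            (S.flip (leftCoord Y (f.symm z))).comp (chartFrame f z).inverse)
        have h1 := contDiffAt_leftCoord hf hz (Y := Y) hY.contMDiffAt
        have hF : ContDiffAt ℝ ∞ F (f p) :=
          (hX.contDiffAt hz).clm_comp ((h1.fderiv_right (by simp)).add
            ((S.flip.contDiff.contDiffAt.comp _ h1).clm_comp
              (hX.contDiffOn_inverse.contDiffAt (hX.isOpen.mem_nhds hz))))
        refine (hF.contMDiffAt.comp p (contMDiffAt_of_mem_maximalAtlas hf hp)).congr_of_eventuallyEq
          ?_
        filter_upwards [f.open_source.mem_nhds hp] with q hq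
        ext v
        have e1 : (trivializationAt E (TangentSpace 𝓘(ℝ, E)) p).continuousLinearMapAt ℝ q =
            modelDeriv E E f q := TangentBundle.continuousLinearMapAt_trivializationAt hq
        have e2 : (trivializationAt E (TangentSpace 𝓘(ℝ, E)) p).symmL ℝ q =
            modelDeriv E E f.symm (f q) := by
          refine (TangentBundle.symmL_trivializationAt hq).trans ?_
          rw [ModelWithCorners.range_eq_univ, mfderivWithin_univ]
          rfl
        have e3 := leftInvariantConnectionMap_eq_comp (S := S) hf (f.map_source hq) (Y := Y)
          ((hY _).mdifferentiableAt (by simp)) v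
        rw [f.left_inv hq] at e3
        have e4 : (F ∘ f) q v = chartFrame f (f q) (fderiv ℝ (fun w ↦ leftCoord Y (f.symm w))
          (f q) v +
            S ((chartFrame f (f q)).inverse v) (leftCoord Y q)) := by
          simp only [F, Function.comp_apply, ContinuousLinearMap.comp_apply, f.left_inv hq,
            _root_.add_apply, ContinuousLinearMap.flip_apply]
        refine Eq.trans ?_ (e3.trans e4.symm)
        exact congrArg₂ (fun A C : E →L[ℝ] E ↦ A (leftInvariantConnectionMap S Y q (C v))) e1 e2 }

end Connection

/-! ### Affine charts and the flat structure on the product -/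

section ChartChange
variable {E : Type*} [NormedAddCommGroup E] [NormedSpace ℝ E] [CompleteSpace E]

/-- The inverse function theorem, with smoothness of the inverse on a whole neighbourhood. -/
lemma exists_openPartialHomeomorph_of_fderiv_eq_id {Φ : E → E} {U : Set E} (hU : IsOpen U)
    (hΦ : ContDiffOn ℝ ∞ Φ U) {z₀ : E} (hz₀ : z₀ ∈ U)
    (h : fderiv ℝ Φ z₀ = ContinuousLinearMap.id ℝ E) :
    ∃ e : OpenPartialHomeomorph E E, e.source ⊆ U ∧ z₀ ∈ e.source ∧ (e : E → E) = Φ ∧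
      ContDiffOn ℝ ∞ e.symm e.target := by
  have hat {z : E} (hz : z ∈ U) : ContDiffAt ℝ ∞ Φ z := hΦ.contDiffAt (hU.mem_nhds hz)
  have hd : HasFDerivAt Φ ((ContinuousLinearEquiv.refl ℝ E : E ≃L[ℝ] E) : E →L[ℝ] E) z₀ := by
    rw [ContinuousLinearEquiv.coe_refl, ← h]
    exact ((hat hz₀).differentiableAt (by simp)).hasFDerivAt
  let e₀ := (hat hz₀).toOpenPartialHomeomorph Φ hd (by simp)
  let W : Set E := U ∩ fderiv ℝ Φ ⁻¹' Set.range ((↑) : (E ≃L[ℝ] E) → E →L[ℝ] E)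
  have hW : IsOpen W := (hΦ.continuousOn_fderiv_of_isOpen hU (by simp)).isOpen_inter_preimage hU
    ContinuousLinearEquiv.isOpen
  refine ⟨e₀.restrOpen W hW, fun z hz ↦ hz.2.1, ⟨(hat hz₀).mem_toOpenPartialHomeomorph_source hd
    (by simp), hz₀, ⟨.refl ℝ E, h.symm⟩⟩, rfl, fun w hw ↦ ?_⟩
  obtain ⟨-, hzU, A, hA⟩ := (e₀.restrOpen W hW).map_target hw
  refine ((e₀.restrOpen W hW).contDiffAt_symm hw (f₀' := A) ?_ (hat hzU)).contDiffWithinAt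
  rw [hA]
  exact ((hat hzU).differentiableAt (by simp)).hasFDerivAt

variable [FiniteDimensional ℝ E]
  {G : Type*} [Group G] [TopologicalSpace G] [ChartedSpace E G] [LieGroup 𝓘(ℝ, E) ∞ G]
  {f : OpenPartialHomeomorph G E}

/-- If the second derivatives of `Φ` along the frame of the chart `f` are given by `S`, then the
frame of the chart `Φ ∘ f` has its derivatives along itself given by `S`. -/
lemma exists_chart_fderiv_chartFrame (hf : f ∈ IsManifold.maximalAtlas 𝓘(ℝ, E) ∞ G)
    {S : E → E → E} {Φ : E → E} {U : Set E} (hU : IsOpen U) (hUf : U ⊆ f.target)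
    (hΦ : ContDiffOn ℝ ∞ Φ U) {p : G} (hp : p ∈ f.source) (hpU : f p ∈ U)
    (h : fderiv ℝ Φ (f p) = ContinuousLinearMap.id ℝ E)
    (hS : ∀ z ∈ U, ∀ x y, frameDeriv (chartFrame f) x (frameDeriv (chartFrame f) y Φ) z =
      frameDeriv (chartFrame f) (S x y) Φ z) :
    ∃ f' ∈ IsManifold.maximalAtlas 𝓘(ℝ, E) ∞ G, p ∈ f'.source ∧ ∀ z ∈ f'.target, ∀ x y,
      fderiv ℝ (chartFrame f') z (chartFrame f' z x) y = chartFrame f' z (S x y) := by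
  obtain ⟨e, heU, hpe, rfl, he⟩ := exists_openPartialHomeomorph_of_fderiv_eq_id hU hΦ hpU h
  have hef : f.trans e ∈ IsManifold.maximalAtlas 𝓘(ℝ, E) ∞ G := by
    refine OpenPartialHomeomorph.mem_maximalAtlas_of_contMDiffOn _ ?_ ?_
    · exact ((hΦ.mono heU).contMDiffOn).comp
        ((contMDiffOn_of_mem_maximalAtlas hf).mono fun q hq ↦ hq.1) fun q hq ↦ hq.2
    · exact (contMDiffOn_symm_of_mem_maximalAtlas hf).comp
        (he.contMDiffOn.mono fun q hq ↦ hq.1) fun q hq ↦ hq.2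
  refine ⟨f.trans e, hef, ⟨hp, hpe⟩, fun w hw x y ↦ ?_⟩
  have hX' := isSmoothFrameOn_chartFrame hef
  have key {z : E} (hz : z ∈ e.source) (v : E) :
      chartFrame (f.trans e) (e z) v = frameDeriv (chartFrame f) v e z := by
    have h1 : (f.trans e).symm (e z) = f.symm z := congrArg f.symm (e.left_inv hz)
    have hzf := hUf (heU hz)
    have h2 : modelDeriv E E (f.trans e) (f.symm z) =
        (fderiv ℝ e z).comp (modelDeriv E E f (f.symm z)) := by
      have := modelDeriv_comp (f := f) (g := e) (p := f.symm z)
        (by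
          rw [f.right_inv hzf]
          exact ((hΦ.contDiffAt (hU.mem_nhds (heU hz))).differentiableAt
            (by simp)).mdifferentiableAt)
        ((contMDiffAt_of_mem_maximalAtlas hf (f.map_target hzf)).mdifferentiableAt (by simp))
      rw [f.right_inv hzf, modelDeriv_eq_fderiv] at this
      exact this
    rw [chartFrame, h1, h2]
    rfl
  obtain ⟨z, hz, rfl⟩ : ∃ z ∈ e.source, e z = w :=
    ⟨e.symm w, e.map_target hw.1, e.right_inv hw.1⟩
  have hd := (hΦ.contDiffAt (hU.mem_nhds (heU hz))).differentiableAt (by simp)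
  have h1 : HasFDerivAt (fun z ↦ chartFrame (f.trans e) (e z) y) _ z :=
    ((hX'.differentiableAt hw).hasFDerivAt.comp z hd.hasFDerivAt).clm_apply (hasFDerivAt_const y z)
  have h2 : fderiv ℝ (frameDeriv (chartFrame f) y e) z =
      fderiv ℝ (fun z ↦ chartFrame (f.trans e) (e z) y) z :=
    Filter.EventuallyEq.fderiv_eq (by
      filter_upwards [e.open_source.mem_nhds hz] with z hz using (key hz y).symm)
  rw [key hz (S x y), ← hS z (heU hz) x y, key hz x, frameDeriv, frameDeriv, h2, h1.fderiv]
  simp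

/-- A bilinear map that gives the derivatives of the left invariant frame along itself in a chart at
the identity defines a left invariant flat affine structure. -/
theorem isIFAS_leftInvariantConnection (hf : f ∈ IsManifold.maximalAtlas 𝓘(ℝ, E) ∞ G)
    (h1 : (1 : G) ∈ f.source) {S : E →L[ℝ] E →L[ℝ] E}
    (h : ∀ z ∈ f.target, ∀ x y, fderiv ℝ (chartFrame f) z (chartFrame f z x) y =
      chartFrame f z (S x y)) :
    IsIFAS (leftInvariantConnection S : CovariantDerivative 𝓘(ℝ, E) E
      (TangentSpace 𝓘(ℝ, E) : G → Type _)) where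
  smooth := leftInvariantConnection_contMDiff S
  torsion_free := leftInvariantConnection_torsion fun x y ↦
    invariantBilinear_sub_of_chart hf (f.map_source h1) (η := 0)
      (B := (ContinuousLinearMap.coeLM ℝ).comp S.toLinearMap) (fun x y ↦ by
        simpa using h _ (f.map_source h1) x y) x y
  flat p := by
    obtain ⟨f', hf', hp, ht, he⟩ := exists_translated_chart hf h1 p
    refine ⟨f', hf', hp, connectionEqOn_leftInvariantConnection hf' fun z hz x y ↦ ?_⟩
    rw [ht] at hz
    have hev : chartFrame f' =ᶠ[nhds z] chartFrame f := by
      filter_upwards [f.open_target.mem_nhds hz] with w hw using he hw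
    rw [hev.fderiv_eq, he hz, h z hz]
  left_invariant g := leftInvariantConnection_left_invariant S g

end ChartChange

end

theorem proposition6p2 {𝔩 : Type*} [LieRing 𝔩] [LieAlgebra ℝ 𝔩] {𝔥 : Type*} [LieRing 𝔥]
    [LieAlgebra ℝ 𝔥] (h𝔩 : AdmitsIFPS 𝔩) (h𝔥 : AdmitsReducibleIFAS 𝔥) :
    AdmitsIFAS (𝔩 × 𝔥) := by
  obtain ⟨L, D₁, hD₁⟩ := h𝔩
  obtain ⟨H, D₂, hD₂, hred⟩ := h𝔥
  obtain ⟨f₁, hf₁, h1₁, hB₁⟩ := hD₁.exists_fderiv_chartFrame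
  obtain ⟨f₂, hf₂, h1₂, hB₂⟩ := hD₂.exists_fderiv_chartFrame
  obtain ⟨α, e, hα, hBe, hBα⟩ := hred.exists_linearForm
  have hf := prodChart_mem_maximalAtlas hf₁ hf₂
  have h1 : (1 : L.G × H.G) ∈ (f₁.prod f₂).source := ⟨h1₁, h1₂⟩
  obtain ⟨S, U, hUt, hU, hpU, Φ, hΦ, hdΦ, hS⟩ := exists_affine_coordinates
    (isSmoothFrameOn_chartFrame hf₁) (isSmoothFrameOn_chartFrame hf₂) hB₁ hB₂ hα hBe hBα
    (p₀ := (f₁.prod f₂) 1) ((f₁.prod f₂).map_source h1)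
  have hfr {V : Type _} [NormedAddCommGroup V] [NormedSpace ℝ V] (x : L.E × H.E)
      (k : L.E × H.E → V) {z : L.E × H.E} (hz : z ∈ U) :
      frameDeriv (chartFrame (f₁.prod f₂)) x k z =
      frameDeriv (prodFrame (chartFrame f₁) (chartFrame f₂)) x k z := by
    rw [frameDeriv, frameDeriv, chartFrame_prod hf₁ hf₂ (hUt hz)]
  obtain ⟨f, hf', hp, hfS⟩ := exists_chart_fderiv_chartFrame hf (S := fun x y ↦ S x y) hU hUt hΦ h1
    hpU hdΦ fun z hz x y ↦ by
      rw [hfr _ _ hz, hfr _ _ hz, ← hS z hz]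
      exact frameDeriv_congr hU (fun w hw ↦ hfr y Φ hw) x hz
  exact ⟨L.prod H, leftInvariantConnection S.toContinuousBilinearMap,
    isIFAS_leftInvariantConnection hf' hp hfS⟩
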